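/- Let $\pi:Y\to X$ be a fibration (smooth surjective submersion), $\dim X=n\ge 1$, $\dim Y=n+m$, with fibered coordinates $(x^i,y^\sigma)$ and jet coordinates $y^\sigma_I$. Forms on $J^kY$ are identified with their pullbacks to higher jet spaces. For a form $\alpha$, let $p_k\alpha$ be its $k$-contact component, $h=p_0$ the horizontalization, and $d_H\alpha=\sum_k p_k\,d\,p_k\alpha$. For an $(n+1)$-form $\alpha$ let $$\mathcal I(\alpha)=\omega^\sigma\wedge\sum_{I}(-1)^{|I|}d_I\Big(\frac{\partial}{\partial y^\sigma_I}\rfloor p_1\alpha\Big),\qquad \omega^\sigma=dy^\sigma-y^\sigma_i\,dx^i,$$ where $d_I$ are the iterated formal (total) derivatives, and let a residual $\mathcal R(\alpha)$ be any local contact $n$-form with $p_1\alpha=\mathcal I(\alpha)+p_1\,d\,p_1\mathcal R(\alpha)$. For a $\pi$-projectable vector field $\psi$ on $Y$ with jet prolongation $J\psi$, let $J\psi_H$ (written $\psi_H$) and $J\psi_V$ be the horizontal and the vertical (contact) parts of $J\psi$. The Noether current of a Lagrangian (horizontal $n$-form) $\lambda$ associated with $\psi$ is $$\epsilon_\psi(\lambda)=J\psi_V\rfloor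 p_{d_V\lambda}+\psi_H\rfloor\lambda,\qquad p_{d_V\lambda}=-p_1\mathcal R(d\lambda).$$ Let $\rho$ be an $n$-form on $J^rY$, let $\psi_1,\dots,\psi_l$ be $\pi$-projectable vector fields on $Y$, and let $\lambda_0=h\rho$, $\lambda_k=L_{J\psi_k}\cdots L_{J\psi_1}h\rho$ be the $k$-th variation. Let $1\le s<l$ and suppose that * $\psi_l$ is a symmetry of the $(l-1)$-th variation: $L_{J\psi_l}\lambda_{l-1}=0$; * $\psi_s$ is a Jacobi field of the $(s-1)$-th variation: $\psi_s$ is vertical and $\mathcal I\,d\big(\psi_s\rfloor\mathcal I\,d\lambda_{s-1}\big)=0$. Then in every fibered chart residuals for the successive currents $\epsilon_{\psi_{s+1}},\dots,\epsilon_{\psi_l}$ exist over the whole chart, and for every choice of them $$d_H\epsilon_{\psi_l}\,d_H\epsilon_{\psi_{l-1}}\cdots d_H\epsilon_{\psi_{s+1}}\big(L_{J\psi_s}\cdots L_{J\psi_1}h\rho\big)=0$$ identically on the jet space, i.e. along every section and not only along extremals. -/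

import Mathlib

open scoped Manifold ContDiff

/-! ### Jet coordinates over `ℝⁿ × ℝᵐ → ℝⁿ` -/

/-- The coordinate space `ℝⁿ × ℝᵐ`, with coordinates `(xⁱ, y^σ)`. -/
abbrev FibCoord (n m : ℕ) : Type := (Fin n → ℝ) × (Fin m → ℝ)

/-- Coordinates `(xⁱ, y^σ_I)` of infinite jets, `I` ranging over all (unordered) multi-indices,
written through their exponents: `I i` is the number of derivatives in the direction `i`. The
same type is used for the tangent vectors. Forms on a finite jet space are identified with their
pullbacks to infinite jets, which is how equalities up to pullbacks by projections are read. -/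
abbrev Jet (n m : ℕ) : Type := (Fin n → ℝ) × ((Fin n → ℕ) → Fin m → ℝ)

/-- Multi-indices of length at most `k`. -/
abbrev MultiIdx (n k : ℕ) : Type := {I : Fin n → ℕ // ∑ i, I i ≤ k}

instance instFiniteMultiIdx (n k : ℕ) : Finite (MultiIdx n k) := by
  refine Set.Finite.to_subtype (s := {I : Fin n → ℕ | ∑ i, I i ≤ k}) ?_
  refine (Set.finite_Iic (fun _ : Fin n => k)).subset ?_
  intro I hI i
  exact (Finset.single_le_sum (fun j _ => Nat.zero_le (I j)) (Finset.mem_univ i)).trans hI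

noncomputable instance instFintypeMultiIdx (n k : ℕ) : Fintype (MultiIdx n k) :=
  Fintype.ofFinite _

/-- Coordinates `(xⁱ, y^σ_I)`, `|I| ≤ k`, of jets of order `k`. -/
abbrev FJet (n m k : ℕ) : Type := (Fin n → ℝ) × (MultiIdx n k → Fin m → ℝ)

noncomputable section

/-- Projection of infinite jets onto jets of order `k`. -/
def truncJet {n m : ℕ} (k : ℕ) (z : Jet n m) : FJet n m k := (z.1, fun I => z.2 I.1)

/-- Projection of infinite jets onto `ℝⁿ × ℝᵐ`. -/
def jetBase {n m : ℕ} (z : Jet n m) : FibCoord n m := (z.1, z.2 0)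

/-- Projection of jets of order `k` onto `ℝⁿ × ℝᵐ`. -/
def fjetBase {n m k : ℕ} (p : FJet n m k) : FibCoord n m := (p.1, p.2 ⟨0, by simp⟩)

/-- Iterating operators along a multi-index: `D_0^{I 0} ⋯ D_{n-1}^{I (n-1)} f`. -/
def iterOp {n : ℕ} {α : Type*} (D : Fin n → α → α) (I : Fin n → ℕ) (f : α) : α :=
  (List.finRange n).foldr (fun i g => (D i)^[I i] g) f

/-- Iterated partial derivative `∂_I f` of a map on `ℝⁿ`. -/
def partialI {n m : ℕ} (I : Fin n → ℕ) (f : (Fin n → ℝ) → (Fin m → ℝ)) :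
    (Fin n → ℝ) → (Fin m → ℝ) :=
  iterOp (fun i g x => lineDeriv ℝ g x (Pi.single i 1)) I f

/-- The jet of order `k` at `x` of the section `x ↦ (x, f x)`. -/
def jetOf {n m : ℕ} (k : ℕ) (f : (Fin n → ℝ) → (Fin m → ℝ)) (x : Fin n → ℝ) : FJet n m k :=
  (x, fun I => partialI I.1 f x)

/-- The polynomial section of degree at most `k` whose jet of order `k` at `p.1` is `p`. -/
def taylorSection {n m k : ℕ} (p : FJet n m k) (x : Fin n → ℝ) : Fin m → ℝ :=
  ∑ I : MultiIdx n k,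
    (∏ i, (x i - p.1 i) ^ (I.1 i) / ((I.1 i).factorial : ℝ)) • p.2 I

/-- The formal derivative `d_i`, a vector field on infinite jets: its value at the jet of `γ` is
the derivative of the prolongation of `γ` in the direction `xⁱ`. -/
def formalDeriv {n m : ℕ} (i : Fin n) (z : Jet n m) : Jet n m :=
  (Pi.single i 1, fun I => z.2 (I + Pi.single i 1))

/-- The action of `d_i` on functions. -/
def totD {n m : ℕ} (i : Fin n) (f : Jet n m → ℝ) : Jet n m → ℝ :=
  fun z => lineDeriv ℝ f z (formalDeriv i z)

/-- The coordinate vector `∂/∂y^σ_I`. -/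
def coordVec {n m : ℕ} (I : Fin n → ℕ) (σ : Fin m) : Jet n m :=
  (0, Pi.single I (Pi.single σ 1))

/-- The horizontal part `v^i d_i` of a tangent vector `v` at `z`. -/
def horVec {n m : ℕ} (z v : Jet n m) : Jet n m := ∑ i, v.1 i • formalDeriv i z

/-- The contact (vertical) part of a tangent vector `v` at `z`; its component `(I, σ)` is
`ω^σ_I (v) = dy^σ_I (v) - y^σ_{Ii} dx^i (v)`. -/
def conVec {n m : ℕ} (z v : Jet n m) : Jet n m := v - horVec z v

/-! ### Differential forms on jets, in coordinates -/

/-- `q`-forms on jets, given by their values on `q` tangent vectors. Being a smooth alternating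
form of finite order is the predicate `IsJetForm`. -/
abbrev JForm (n m q : ℕ) : Type := Jet n m → (Fin q → Jet n m) → ℝ

/-- `α` is, over the open set `U ⊆ ℝⁿ × ℝᵐ`, the pullback of a smooth `q`-form on the jets of
order `k`. -/
def IsJetForm {n m q : ℕ} (U : Set (FibCoord n m)) (k : ℕ) (α : JForm n m q) : Prop :=
  ∃ α' : FJet n m k → (FJet n m k) [⋀^Fin q]→L[ℝ] ℝ,
    ContDiffOn ℝ ∞ α' {p | fjetBase p ∈ U} ∧
    ∀ z, jetBase z ∈ U → ∀ v, α z v = α' (truncJet k z) (fun i => truncJet k (v i))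

/-- Exterior derivative. -/
def extD {n m q : ℕ} (α : JForm n m q) : JForm n m (q + 1) := fun z v =>
  ∑ i : Fin (q + 1), (-1 : ℝ) ^ (i : ℕ) * lineDeriv ℝ (fun w => α w (i.removeNth v)) z (v i)

/-- Contraction `X ⌋ α` with a vector field. -/
def contr {n m q : ℕ} (X : Jet n m → Jet n m) (α : JForm n m (q + 1)) : JForm n m q :=
  fun z v => α z (Fin.cons (X z) v)

/-- Lie derivative `L_X α = X ⌋ dα + d (X ⌋ α)`. -/
def lieD {n m q : ℕ} (X : Jet n m → Jet n m) (α : JForm n m (q + 1)) : JForm n m (q + 1) :=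
  fun z v => contr X (extD α) z v + extD (contr X α) z v

/-- The `k`-contact component `p_k α`: exactly `k` of the arguments are replaced by their contact
parts and the others by their horizontal parts. In particular `p_0` is the horizontalization. -/
def pCon {n m q : ℕ} (k : ℕ) (α : JForm n m q) : JForm n m q := fun z v =>
  ∑ S ∈ Finset.powersetCard k (Finset.univ : Finset (Fin q)),
    α z (fun i => if i ∈ S then conVec z (v i) else horVec z (v i))

/-- Horizontalization `h = p_0`. -/
def horiz {n m q : ℕ} (α : JForm n m q) : JForm n m q := pCon 0 α

/-- Horizontal differential `d_H α = ∑_l p_l d p_l α`. -/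
def dH {n m q : ℕ} (α : JForm n m q) : JForm n m (q + 1) := fun z v =>
  ∑ l ∈ Finset.range (q + 1), pCon l (extD (pCon l α)) z v

/-- The action on forms of the iterated formal derivative `d_I`. -/
def formD {n m q : ℕ} (I : Fin n → ℕ) (α : JForm n m (q + 1)) : JForm n m (q + 1) :=
  iterOp (fun i => lieD (formalDeriv i)) I α

/-- The exterior product `ω^σ ∧ β` with the contact form `ω^σ = dy^σ - y^σ_i dx^i`. -/
def contactWedge {n m q : ℕ} (σ : Fin m) (β : JForm n m q) : JForm n m (q + 1) := fun z v =>
  ∑ i : Fin (q + 1), (-1 : ℝ) ^ (i : ℕ) * ((conVec z (v i)).2 0 σ * β z (i.removeNth v))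

/-- Interior Euler operator on `(n+1)`-forms over an `n`-dimensional base (here applied with
`n = q + 1`): `I(ρ) = ω^σ ∧ ∑_I (-1)^{|I|} d_I (∂/∂y^σ_I ⌋ p_1 ρ)`. Only the multi-indices of
length at most the order of `ρ` contribute, so that the sum is finite. -/
def interiorEuler {n m q : ℕ} (ρ : JForm n m (q + 2)) : JForm n m (q + 2) := fun z v =>
  ∑ σ : Fin m, contactWedge σ
    (fun z v => ∑ᶠ I : Fin n → ℕ,
      (-1 : ℝ) ^ (∑ i, I i) * formD I (contr (fun _ => coordVec I σ) (pCon 1 ρ)) z v) z v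

/-- The prolongation to jets of the projectable vector field `ξ^i ∂/∂x^i + Ξ^σ ∂/∂y^σ`: its
component along `∂/∂y^σ_I` is `d_I (Ξ^σ - y^σ_i ξ^i) + y^σ_{Ii} ξ^i`. -/
def prolong {n m : ℕ} (X : FibCoord n m → FibCoord n m) (z : Jet n m) : Jet n m :=
  ((X (jetBase z)).1, fun I σ =>
    iterOp totD I
      (fun w => (X (jetBase w)).2 σ - ∑ i, w.2 (Pi.single i 1) σ * (X (jetBase w)).1 i) z
      + ∑ i, z.2 (I + Pi.single i 1) σ * (X (jetBase z)).1 i)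

/-- `R` is, over `U`, a residual `𝓡(ρ)` of the `(n+1)`-form `ρ` (`n = q + 1`): a contact `n`-form
of finite order with `p_1 ρ = I(ρ) + p_1 d p_1 R`. -/
def IsResidual {n m q : ℕ} (U : Set (FibCoord n m)) (ρ : JForm n m (q + 2))
    (R : JForm n m (q + 1)) : Prop :=
  (∃ k, IsJetForm U k R) ∧
  (∀ z, jetBase z ∈ U → ∀ v, horiz R z v = 0) ∧
  ∀ z, jetBase z ∈ U → ∀ v,
    pCon 1 ρ z v = interiorEuler ρ z v + pCon 1 (extD (pCon 1 R)) z v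

/-- The Noether current `ε_ψ(lam) = Jψ_V ⌋ p_{d_V lam} + ψ_H ⌋ lam` for the generalized momentum
`p_{d_V lam} = - p_1 R`, where `R` is a residual of `d lam` and `X` represents `ψ`. -/
def noetherCurrent {n m q : ℕ} (X : FibCoord n m → FibCoord n m) (R lam : JForm n m (q + 1)) :
    JForm n m q := fun z v =>
  contr (fun z => conVec z (prolong X z)) (fun z v => - pCon 1 R z v) z v
    + contr (fun z => horVec z (prolong X z)) lam z v

/-- Iterated horizontal differentials of Noether currents, starting from `lam`: the value at `j`
is `d_H ε_{X_j} ⋯ d_H ε_{X_1} (lam)`, where the current of the `j`-th intermediate Lagrangian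
(counting from `0`) is formed with the residual `R j`. -/
def iterCurrent {n m q : ℕ} (X : ℕ → FibCoord n m → FibCoord n m) (R : ℕ → JForm n m (q + 1))
    (lam : JForm n m (q + 1)) : ℕ → JForm n m (q + 1)
  | 0 => lam
  | j + 1 => dH (noetherCurrent (X (j + 1)) (R j) (iterCurrent X R lam j))

/-- `R 0, …, R (N-1)` are residuals for the exterior differentials of the successive Lagrangians
of `iterCurrent`. -/
def IsResidualChain {n m q : ℕ} (U : Set (FibCoord n m)) (X : ℕ → FibCoord n m → FibCoord n m)
    (lam : JForm n m (q + 1)) (N : ℕ) (R : ℕ → JForm n m (q + 1)) : Prop :=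
  ∀ j < N, IsResidual U (extD (iterCurrent X R lam j)) (R j)

/-! ### Fibered manifolds -/

section Manifolds

variable {n m : ℕ} {X Y : Type*} [TopologicalSpace X] [ChartedSpace (Fin n → ℝ) X]
  [TopologicalSpace Y] [ChartedSpace (FibCoord n m) Y]

/-- Fibered charts of `π : Y → X`: smooth charts of `Y` and `X` such that `π` is `(x, y) ↦ x`. -/
structure FiberedChart (n m : ℕ) {X Y : Type*} [TopologicalSpace X]
    [ChartedSpace (Fin n → ℝ) X] [TopologicalSpace Y] [ChartedSpace (FibCoord n m) Y]
    (π : Y → X) where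
  chartY : OpenPartialHomeomorph Y (FibCoord n m)
  chartX : OpenPartialHomeomorph X (Fin n → ℝ)
  chartY_mem : chartY ∈ IsManifold.maximalAtlas 𝓘(ℝ, FibCoord n m) ∞ Y
  chartX_mem : chartX ∈ IsManifold.maximalAtlas 𝓘(ℝ, Fin n → ℝ) ∞ X
  map_source : ∀ y ∈ chartY.source, π y ∈ chartX.source
  fst_eq : ∀ y ∈ chartY.source, (chartY y).1 = chartX (π y)

/-- The open subset of `ℝⁿ × ℝᵐ` over which a fibered chart gives coordinates. -/
def FiberedChart.dom {π : Y → X} (c : FiberedChart n m π) : Set (FibCoord n m) := c.chartY.target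

/-- Change of coordinates on jets of order `k` between the fibered charts `c` and `c'`: the jet of
a section in the chart `c` is sent to the jet of the same section in the chart `c'`. -/
def FiberedChart.trans {π : Y → X} (c c' : FiberedChart n m π) (k : ℕ) (p : FJet n m k) :
    FJet n m k :=
  jetOf k
    (fun x' => (c'.chartY (c.chartY.symm
      (c.chartX (c'.chartX.symm x'),
        taylorSection p (c.chartX (c'.chartX.symm x'))))).2)
    (c'.chartX (c.chartX.symm p.1))

/-- Smooth `q`-forms on `J^k Y`: smooth local representatives in all fibered charts, related by
pullback along the changes of jet coordinates. -/
structure FormOnJets (k q : ℕ) (π : Y → X) where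
  rep : FiberedChart n m π → FJet n m k → (FJet n m k) [⋀^Fin q]→L[ℝ] ℝ
  smooth : ∀ c : FiberedChart n m π, ContDiffOn ℝ ∞ (rep c) {p | fjetBase p ∈ c.dom}
  compat : ∀ (c c' : FiberedChart n m π) (p : FJet n m k), fjetBase p ∈ c.dom →
    c.chartY.symm (fjetBase p) ∈ c'.chartY.source →
      rep c p = (rep c' (c.trans c' k p)).compContinuousLinearMap (fderiv ℝ (c.trans c' k) p)

/-- The representative of a form on `J^k Y` in a fibered chart, pulled back to infinite jets. -/
def FormOnJets.inChart {k q : ℕ} {π : Y → X} (ρ : FormOnJets (n := n) (m := m) k q π)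
    (c : FiberedChart n m π) : JForm n m q :=
  fun z v => ρ.rep c (truncJet k z) (fun i => truncJet k (v i))

/-- The coordinate expression of a vector field on `Y` in a fibered chart. -/
def FiberedChart.repField {π : Y → X} (c : FiberedChart n m π)
    (ψ : (y : Y) → TangentSpace 𝓘(ℝ, FibCoord n m) y) (p : FibCoord n m) : FibCoord n m :=
  mfderiv 𝓘(ℝ, FibCoord n m) 𝓘(ℝ, FibCoord n m) c.chartY (c.chartY.symm p)
    (ψ (c.chartY.symm p))

/-- `ψ` is a smooth `π`-projectable vector field on `Y`. -/
def IsProjectableField (n m : ℕ) {X Y : Type*} [TopologicalSpace X]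
    [ChartedSpace (Fin n → ℝ) X] [TopologicalSpace Y] [ChartedSpace (FibCoord n m) Y]
    [IsManifold 𝓘(ℝ, FibCoord n m) ∞ Y] (π : Y → X)
    (ψ : (y : Y) → TangentSpace 𝓘(ℝ, FibCoord n m) y) : Prop :=
  ContMDiff 𝓘(ℝ, FibCoord n m) (𝓘(ℝ, FibCoord n m).tangent) ∞
    (fun y => (⟨y, ψ y⟩ : TangentBundle 𝓘(ℝ, FibCoord n m) Y)) ∧
  ∃ ξ : (x : X) → TangentSpace 𝓘(ℝ, Fin n → ℝ) x,
    ∀ y, mfderiv 𝓘(ℝ, FibCoord n m) 𝓘(ℝ, Fin n → ℝ) π y (ψ y) = ξ (π y)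

/-- `ψ` is vertical: tangent to the fibres of `π`. -/
def IsVerticalField (n m : ℕ) {X Y : Type*} [TopologicalSpace X]
    [ChartedSpace (Fin n → ℝ) X] [TopologicalSpace Y] [ChartedSpace (FibCoord n m) Y]
    (π : Y → X) (ψ : (y : Y) → TangentSpace 𝓘(ℝ, FibCoord n m) y) : Prop :=
  ∀ y, mfderiv 𝓘(ℝ, FibCoord n m) 𝓘(ℝ, Fin n → ℝ) π y (ψ y) = 0

/-- A form, given by its expression in the chart `c`, vanishes identically over that chart (at
all jets of points of the chart, hence along all sections). -/
def FiberedChart.Vanishes {π : Y → X} (c : FiberedChart n m π) {q : ℕ} (α : JForm n m q) : Prop :=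
  ∀ z, jetBase z ∈ c.dom → ∀ v, α z v = 0

/-- The `k`-th variation `L_{Jψ_k} ⋯ L_{Jψ_1} hρ`, in the chart `c`. -/
def variation {r q : ℕ} {π : Y → X} (ρ : FormOnJets (n := n) (m := m) r (q + 1) π)
    (ψ : ℕ → (y : Y) → TangentSpace 𝓘(ℝ, FibCoord n m) y) (c : FiberedChart n m π) :
    ℕ → JForm n m (q + 1)
  | 0 => horiz (ρ.inChart c)
  | k + 1 => lieD (prolong (c.repField (ψ (k + 1)))) (variation ρ ψ c k)

/-- `ψ` is a symmetry of the Lagrangian `lam` (given in all fibered charts): `L_{Jψ} lam = 0`. -/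
def IsLagrangianSymmetry {q : ℕ} {π : Y → X} (lam : FiberedChart n m π → JForm n m (q + 1))
    (ψ : (y : Y) → TangentSpace 𝓘(ℝ, FibCoord n m) y) : Prop :=
  ∀ c : FiberedChart n m π, c.Vanishes (lieD (prolong (c.repField ψ)) (lam c))

/-- `ψ` is a Jacobi field of the Lagrangian `lam` (given in all fibered charts): `ψ` is vertical
and `I d (ψ ⌋ I d lam) = 0`. -/
def IsJacobiField {q : ℕ} {π : Y → X} (lam : FiberedChart n m π → JForm n m (q + 1))
    (ψ : (y : Y) → TangentSpace 𝓘(ℝ, FibCoord n m) y) : Prop :=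
  IsVerticalField n m π ψ ∧
  ∀ c : FiberedChart n m π, c.Vanishes
    (interiorEuler (extD (contr (prolong (c.repField ψ)) (interiorEuler (extD (lam c))))))

end Manifolds

end

/-! Over a chart every Lagrangian involved is `f vol` with `f` smooth of finite order. For a
projectable field put Q^σ = Ξ^σ - y^σ_i ξ^i. The vertical differential of `f` is recorded by its
symbol, the finite sum of (∂f/∂y^σ_I) w_I. Integration by parts (`exists_parts`) writes this symbol
as E_σ(f) w_0 minus a total divergence, where E_σ(f) is the Euler–Lagrange expression. Substituting
w_I = d_I Q^σ gives the first variation formula L_ψ λ = E_σ Q^σ vol + d_H ε_ψ(λ) (`lieCoeff_eq`,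
`IsVol.dH_noetherCurrent`). It holds for every residual: the 1-contact part of a residual is itself
the divergence term of such a decomposition (`IsVol.exists_symbol_eq_of_isResidual`).

Total divergences have zero Euler–Lagrange expressions, so E(L_ψ λ) = E(E_σ Q^σ vol)
(`eulerCoeff_lieCoeff`). Hence the Jacobi condition on ψ_s makes the Euler–Lagrange expressions of
λ_s vanish identically (`IsVol.eulerCoeff_of_jacobi`). If E(λ) = 0, the first variation formula
reduces to d_H ε_ψ(λ) = L_ψ λ along all sections, and E(L_ψ λ) = 0 again. By induction the iterated
currents reproduce the variations up to λ_l (`iterCurrent_isSameTrivial`), and λ_l = 0 by the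
symmetry assumption.

The algebra takes place in `JetFun U` with the commuting derivations `totDer`. The predicates
`IsVol`, `IsSource`, `IsCurrent` and `IsMomentum` translate operations on forms into operations on
coefficients. -/

noncomputable section

open TopologicalSpace Topology

namespace JetVariation

/-! ### Functions of finite order on jets over an open set -/

section JetFunctions

variable {n m : ℕ}

/-- The projection `truncJet` as a linear map. -/
def truncLin (n m k : ℕ) : Jet n m →ₗ[ℝ] FJet n m k where
  toFun := truncJet k
  map_add' _ _ := rfl
  map_smul' _ _ := rfl

@[simp] lemma truncLin_apply (k : ℕ) (z : Jet n m) : truncLin n m k z = truncJet k z := rfl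

/-- The projection from jets of order `k'` onto jets of order `k ≤ k'`. -/
def restrJet {k k' : ℕ} (h : k ≤ k') : FJet n m k' →L[ℝ] FJet n m k :=
  (ContinuousLinearMap.fst ℝ _ _).prod
    ((ContinuousLinearMap.pi fun I : MultiIdx n k =>
      ContinuousLinearMap.proj (R := ℝ) (φ := fun _ : MultiIdx n k' => Fin m → ℝ)
        ⟨I.1, I.2.trans h⟩).comp (ContinuousLinearMap.snd ℝ _ _))

lemma continuous_fjetBase (k : ℕ) : Continuous (fjetBase : FJet n m k → FibCoord n m) := by
  unfold fjetBase; fun_prop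

lemma isOpen_over (U : Opens (FibCoord n m)) (k : ℕ) :
    IsOpen {p : FJet n m k | fjetBase p ∈ U} :=
  U.isOpen.preimage (continuous_fjetBase k)

lemma eventually_jetBase_mem (U : Opens (FibCoord n m)) {z : Jet n m} (hz : jetBase z ∈ U)
    (v : Jet n m) : ∀ᶠ t : ℝ in 𝓝 0, jetBase (z + t • v) ∈ U := by
  have hc : Continuous fun t : ℝ => jetBase (z + t • v) := by
    have : (fun t : ℝ => jetBase (z + t • v)) = fun t => jetBase z + t • jetBase v := rfl
    rw [this]; fun_prop
  refine hc.continuousAt.eventually_mem (U.isOpen.mem_nhds ?_)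
  simpa using hz

/-- Jets over `U`. -/
abbrev Over (U : Opens (FibCoord n m)) : Type := {z : Jet n m // jetBase z ∈ U}

/-- `f'` represents `f` on jets of order `k`. -/
def Represents (U : Opens (FibCoord n m)) (k : ℕ) (f' : FJet n m k → ℝ) (f : Over U → ℝ) : Prop :=
  ContDiffOn ℝ ∞ f' {p | fjetBase p ∈ U} ∧ ∀ z, f z = f' (truncJet k z.1)

lemma Represents.restr {U : Opens (FibCoord n m)} {k k' : ℕ} (h : k ≤ k') {f' : FJet n m k → ℝ}
    {f : Over U → ℝ} (hf : Represents U k f' f) :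
    Represents U k' (fun p => f' (restrJet h p)) f := by
  refine ⟨?_, fun z => hf.2 z⟩
  exact hf.1.comp (restrJet h).contDiff.contDiffOn fun p hp => hp

/-- The algebra of smooth functions of finite order on the jets over `U`. -/
def JetFun (U : Opens (FibCoord n m)) : Subalgebra ℝ (Over U → ℝ) where
  carrier := {f | ∃ k f', Represents U k f' f}
  mul_mem' := by
    rintro f g ⟨k, f', hf⟩ ⟨l, g', hg⟩
    have hf := hf.restr (le_max_left k l)
    have hg := hg.restr (le_max_right k l)
    exact ⟨_, _, hf.1.mul hg.1, fun z => by simp [hf.2, hg.2]⟩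
  add_mem' := by
    rintro f g ⟨k, f', hf⟩ ⟨l, g', hg⟩
    have hf := hf.restr (le_max_left k l)
    have hg := hg.restr (le_max_right k l)
    exact ⟨_, _, hf.1.add hg.1, fun z => by simp [hf.2, hg.2]⟩
  algebraMap_mem' r := ⟨0, fun _ => r, contDiffOn_const, fun _ => rfl⟩

variable {U : Opens (FibCoord n m)}

lemma exists_represents (f : JetFun U) : ∃ k f', Represents U k f' f.1 := f.2

/-- An order of `f`. -/
def order (f : JetFun U) : ℕ := (exists_represents f).choose

/-- A representative of `f` on jets of finite order. -/
def rep (f : JetFun U) : FJet n m (order f) → ℝ := (exists_represents f).choose_spec.choose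

lemma rep_spec (f : JetFun U) : Represents U (order f) (rep f) f.1 :=
  (exists_represents f).choose_spec.choose_spec

lemma hasDerivAt_truncJet (k : ℕ) (z v : Jet n m) :
    HasDerivAt (fun t : ℝ => truncJet k (z + t • v)) (truncJet k v) 0 := by
  have : (fun t : ℝ => truncJet k (z + t • v)) = fun t => truncJet k z + t • truncJet k v := rfl
  rw [this]
  simpa using ((hasDerivAt_id (0 : ℝ)).smul_const (truncJet k v)).const_add (truncJet k z)

lemma contDiffAt_of_over {k : ℕ} {E : Type*} [NormedAddCommGroup E] [NormedSpace ℝ E]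
    {f' : FJet n m k → E} (hf : ContDiffOn ℝ ∞ f' {p | fjetBase p ∈ U}) {z : Jet n m}
    (hz : jetBase z ∈ U) : ContDiffAt ℝ ∞ f' (truncJet k z) :=
  hf.contDiffAt ((isOpen_over U k).mem_nhds hz)

lemma hasLineDerivAt_congr {g h : Jet n m → ℝ} {c : ℝ} {z v : Jet n m} (hz : jetBase z ∈ U)
    (hgh : ∀ w, jetBase w ∈ U → g w = h w) (hg : HasLineDerivAt ℝ h c z v) :
    HasLineDerivAt ℝ g c z v := by
  refine HasDerivAt.congr_of_eventuallyEq hg ?_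
  filter_upwards [eventually_jetBase_mem U hz v] with t ht using hgh _ ht

lemma lineDeriv_congr_over {g h : Jet n m → ℝ} {z v : Jet n m} (hz : jetBase z ∈ U)
    (hgh : ∀ w, jetBase w ∈ U → g w = h w) : lineDeriv ℝ g z v = lineDeriv ℝ h z v := by
  refine Filter.EventuallyEq.deriv_eq ?_
  filter_upwards [eventually_jetBase_mem U hz v] with t ht using hgh _ ht

lemma Represents.hasLineDerivAt {k : ℕ} {f' : FJet n m k → ℝ} {f : Over U → ℝ}
    (hf : Represents U k f' f) {g : Jet n m → ℝ} (hg : ∀ z (h : jetBase z ∈ U), g z = f ⟨z, h⟩)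
    (z : Over U) (v : Jet n m) :
    HasLineDerivAt ℝ g (fderiv ℝ f' (truncJet k z.1) (truncJet k v)) z.1 v := by
  refine hasLineDerivAt_congr (h := fun w => f' (truncJet k w)) z.2
    (fun w hw => (hg w hw).trans (hf.2 _)) ?_
  have h1 := ((contDiffAt_of_over hf.1 z.2).differentiableAt (by simp)).hasFDerivAt
  have h2 := hasDerivAt_truncJet k z.1 v
  have h3 : truncJet k (z.1 + (0 : ℝ) • v) = truncJet k z.1 := by simp
  rw [← h3] at h1
  have := h1.comp_hasDerivAt (0 : ℝ) h2
  rw [h3] at this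
  exact this

/-- The differential of a function of finite order. -/
def diff (f : JetFun U) (z : Over U) : Jet n m →ₗ[ℝ] ℝ :=
  (fderiv ℝ (rep f) (truncJet (order f) z.1)).toLinearMap ∘ₗ truncLin n m (order f)

lemma hasLineDerivAt_diff (f : JetFun U) {g : Jet n m → ℝ}
    (hg : ∀ z (h : jetBase z ∈ U), g z = f.1 ⟨z, h⟩) (z : Over U) (v : Jet n m) :
    HasLineDerivAt ℝ g (diff f z v) z.1 v :=
  (rep_spec f).hasLineDerivAt hg z v

lemma lineDeriv_eq_diff (f : JetFun U) {g : Jet n m → ℝ}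
    (hg : ∀ z (h : jetBase z ∈ U), g z = f.1 ⟨z, h⟩) (z : Over U) (v : Jet n m) :
    lineDeriv ℝ g z.1 v = diff f z v :=
  (hasLineDerivAt_diff f hg z v).lineDeriv

open Classical in
/-- Extension by zero. -/
def extend (f : Over U → ℝ) (z : Jet n m) : ℝ := if h : jetBase z ∈ U then f ⟨z, h⟩ else 0

lemma extend_eq (f : Over U → ℝ) (z : Jet n m) (h : jetBase z ∈ U) : extend f z = f ⟨z, h⟩ := by
  simp [extend, h]

/-- The differential is defined through a chosen representative, and representatives of sums or
products are chosen independently. Uniqueness of line derivatives removes the dependence on the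
choice; the calculus rules below all come from it. -/
lemma diff_unique (f : JetFun U) {g : Jet n m → ℝ}
    (hg : ∀ z (h : jetBase z ∈ U), g z = f.1 ⟨z, h⟩) {z : Over U} {v : Jet n m} {c : ℝ}
    (h : HasLineDerivAt ℝ g c z.1 v) : diff f z v = c :=
  (hasLineDerivAt_diff f hg z v).unique h

lemma diff_add (f g : JetFun U) (z : Over U) (v : Jet n m) :
    diff (f + g) z v = diff f z v + diff g z v := by
  refine diff_unique (f + g) (g := fun w => extend f.1 w + extend g.1 w)
    (fun w h => by simp [extend_eq _ _ h]) ?_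
  exact (hasLineDerivAt_diff f (extend_eq f.1) z v).add (hasLineDerivAt_diff g (extend_eq g.1) z v)

lemma diff_smul (c : ℝ) (f : JetFun U) (z : Over U) (v : Jet n m) :
    diff (c • f) z v = c * diff f z v := by
  refine diff_unique (c • f) (g := fun w => c * extend f.1 w)
    (fun w h => by simp [extend_eq _ _ h]) ?_
  exact HasDerivAt.const_mul c (hasLineDerivAt_diff f (extend_eq f.1) z v)

lemma diff_mul (f g : JetFun U) (z : Over U) (v : Jet n m) :
    diff (f * g) z v = f.1 z * diff g z v + g.1 z * diff f z v := by
  refine diff_unique (f * g) (g := fun w => extend f.1 w * extend g.1 w)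
    (fun w h => by simp [extend_eq _ _ h]) ?_
  have := HasDerivAt.mul (hasLineDerivAt_diff f (extend_eq f.1) z v)
    (hasLineDerivAt_diff g (extend_eq g.1) z v)
  simp only [zero_smul, add_zero, extend_eq _ _ z.2] at this
  unfold HasLineDerivAt
  rw [mul_comm (g.1 z), add_comm]
  exact this

/-! ### Coordinates -/

/-- The coordinate vectors of the space of jets of order `k`. -/
def frameF {k : ℕ} : Fin n ⊕ (MultiIdx n k × Fin m) → FJet n m k
  | .inl i => (Pi.single i 1, 0)
  | .inr J => (0, Pi.single J.1 (Pi.single J.2 1))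

/-- The coordinates of an infinite jet that enter jets of order `k`. -/
def coordF {k : ℕ} (w : Jet n m) : Fin n ⊕ (MultiIdx n k × Fin m) → ℝ
  | .inl i => w.1 i
  | .inr J => w.2 J.1.1 J.2

lemma truncJet_eq_sum (k : ℕ) (w : Jet n m) :
    truncJet k w = ∑ b : Fin n ⊕ (MultiIdx n k × Fin m), coordF w b • frameF b := by
  rw [Fintype.sum_sum_type, Fintype.sum_prod_type]
  refine Prod.ext ?_ ?_
  · funext i
    simp [truncJet, coordF, frameF, Prod.fst_sum, Finset.sum_apply, Pi.single_apply]
  · funext I σ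
    simp [truncJet, coordF, frameF, Prod.snd_sum, Finset.sum_apply, Pi.single_apply]

lemma truncJet_coordVec {k : ℕ} (I : MultiIdx n k) (σ : Fin m) :
    truncJet k (coordVec I.1 σ) = frameF (.inr (I, σ)) := by
  refine Prod.ext rfl ?_
  funext J τ
  by_cases h : J = I
  · subst h; simp [truncJet, coordVec, frameF]
  · have h' : J.1 ≠ I.1 := fun h' => h (Subtype.ext h')
    simp [truncJet, coordVec, frameF, h, h']

lemma truncJet_coordVec_eq_zero {k : ℕ} {I : Fin n → ℕ} (hI : k < ∑ i, I i) (σ : Fin m) :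
    truncJet k (coordVec I σ) = 0 := by
  refine Prod.ext rfl ?_
  funext J τ
  have h' : J.1 ≠ I := fun h' => by have := J.2; rw [h'] at this; omega
  simp [truncJet, coordVec, h']

lemma map_truncJet_vertical {k : ℕ} (φ : FJet n m k →ₗ[ℝ] ℝ) {w : Jet n m} (hw : w.1 = 0) :
    φ (truncJet k w) =
      ∑ I : MultiIdx n k, ∑ σ, w.2 I.1 σ * φ (truncJet k (coordVec I.1 σ)) := by
  rw [truncJet_eq_sum, Fintype.sum_sum_type, Fintype.sum_prod_type]
  simp [coordF, hw, truncJet_coordVec]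

/-- Vector fields all whose components have finite order. -/
def IsJetField (U : Opens (FibCoord n m)) (W : Jet n m → Jet n m) : Prop :=
  (∀ i, ∃ a : JetFun U, ∀ z : Over U, a.1 z = (W z.1).1 i) ∧
  ∀ I σ, ∃ a : JetFun U, ∀ z : Over U, a.1 z = (W z.1).2 I σ

lemma IsJetField.coordF {W : Jet n m → Jet n m} (hW : IsJetField U W) {k : ℕ}
    (b : Fin n ⊕ (MultiIdx n k × Fin m)) :
    ∃ a : JetFun U, ∀ z : Over U, a.1 z = coordF (W z.1) b := by
  rcases b with i | J
  · exact hW.1 i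
  · exact hW.2 _ _

/-- The coordinate function `y^σ_I`. -/
def yFun (U : Opens (FibCoord n m)) (I : Fin n → ℕ) (σ : Fin m) : JetFun U :=
  ⟨fun z => z.1.2 I σ, ∑ i, I i, fun p => p.2 ⟨I, le_rfl⟩ σ, by fun_prop, fun _ => rfl⟩

lemma isJetField_formalDeriv (i : Fin n) : IsJetField U (formalDeriv (m := m) i) :=
  ⟨fun j => ⟨algebraMap ℝ _ ((Pi.single i 1 : Fin n → ℝ) j), fun _ => rfl⟩,
    fun I σ => ⟨yFun U (I + Pi.single i 1) σ, fun _ => rfl⟩⟩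

lemma isJetField_const (v : Jet n m) : IsJetField U (fun _ => v) :=
  ⟨fun j => ⟨algebraMap ℝ _ (v.1 j), fun _ => rfl⟩,
    fun I σ => ⟨algebraMap ℝ _ (v.2 I σ), fun _ => rfl⟩⟩

/-- Only finitely many coordinates of each argument reach the jets of order `k`. Multilinear
expansion over the finite frame leaves products of component functions with values of the form on
constant vectors, which are smooth. -/
lemma exists_jetFun_alternating {k q : ℕ}
    {α : FJet n m k → (FJet n m k) [⋀^Fin q]→L[ℝ] ℝ}
    (hα : ContDiffOn ℝ ∞ α {p | fjetBase p ∈ U}) {W : Fin q → Jet n m → Jet n m}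
    (hW : ∀ j, IsJetField U (W j)) :
    ∃ a : JetFun U, ∀ z : Over U,
      a.1 z = α (truncJet k z.1) (fun j => truncJet k (W j z.1)) := by
  choose c hc using fun j => fun b => (hW j).coordF (k := k) b
  have he : ∀ r : Fin q → Fin n ⊕ (MultiIdx n k × Fin m), ∃ a : JetFun U, ∀ z : Over U,
      a.1 z = α (truncJet k z.1) (fun j => frameF (r j)) := fun r => by
    refine ⟨⟨_, k, fun p => α p (fun j => frameF (r j)), ?_, fun z => rfl⟩, fun z => rfl⟩
    let L : ((FJet n m k) [⋀^Fin q]→L[ℝ] ℝ) →L[ℝ] ℝ :=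
      ContinuousAlternatingMap.apply ℝ (FJet n m k) ℝ (fun j => frameF (r j))
    exact L.contDiff.comp_contDiffOn hα
  choose e he using he
  refine ⟨∑ r : Fin q → Fin n ⊕ (MultiIdx n k × Fin m), (∏ j, c j (r j)) * e r, fun z => ?_⟩
  have h1 : (fun j => truncJet k (W j z.1)) = fun j => ∑ b, (c j b).1 z • frameF b := by
    funext j; rw [truncJet_eq_sum]; simp [hc]
  rw [h1]
  have h2 := (α (truncJet k z.1)).toMultilinearMap.map_sum
    (fun (j : Fin q) (b : Fin n ⊕ (MultiIdx n k × Fin m)) => (c j b).1 z • frameF b)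
  refine Eq.trans ?_ h2.symm
  simp only [MultilinearMap.map_smul_univ]
  simp [he, Finset.sum_apply, Finset.prod_apply]

lemma exists_jetFun_diff (f : JetFun U) {W : Jet n m → Jet n m} (hW : IsJetField U W) :
    ∃ a : JetFun U, ∀ z : Over U, a.1 z = diff f z (W z.1) := by
  choose c hc using fun b => hW.coordF (k := order f) b
  have he : ∀ b : Fin n ⊕ (MultiIdx n (order f) × Fin m), ∃ a : JetFun U, ∀ z : Over U,
      a.1 z = fderiv ℝ (rep f) (truncJet (order f) z.1) (frameF b) := fun b => by
    refine ⟨⟨_, order f, fun p => fderiv ℝ (rep f) p (frameF b), ?_, fun z => rfl⟩, fun z => rfl⟩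
    exact ((rep_spec f).1.fderiv_of_isOpen (isOpen_over U _) (by simp)).clm_apply contDiffOn_const
  choose e he using he
  refine ⟨∑ b, c b * e b, fun z => ?_⟩
  have h1 : diff f z (W z.1) =
      fderiv ℝ (rep f) (truncJet (order f) z.1) (truncJet (order f) (W z.1)) := rfl
  rw [h1, truncJet_eq_sum _ (W z.1), map_sum]
  simp [he, hc, Finset.sum_apply]

/-- The derivation of the algebra of functions given by a vector field. -/
def lieDer (W : Jet n m → Jet n m) (hW : IsJetField U W) : Derivation ℝ (JetFun U) (JetFun U) :=
  Derivation.mk'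
    { toFun := fun f => ⟨fun z => diff f z (W z.1), by
        obtain ⟨a, ha⟩ := exists_jetFun_diff f hW
        convert a.2 using 1
        funext z; exact (ha z).symm⟩
      map_add' := fun f g => Subtype.ext (funext fun z => diff_add f g z _)
      map_smul' := fun c f => Subtype.ext (funext fun z => diff_smul c f z _) }
    fun f g => Subtype.ext (funext fun z => diff_mul f g z _)

/-- The formal derivative `d_i` on functions over `U`. -/
def totDer (U : Opens (FibCoord n m)) (i : Fin n) : Derivation ℝ (JetFun U) (JetFun U) :=
  lieDer (formalDeriv i) (isJetField_formalDeriv i)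

/-- The partial derivative `∂/∂y^σ_I` on functions over `U`. -/
def coordDer (U : Opens (FibCoord n m)) (I : Fin n → ℕ) (σ : Fin m) :
    Derivation ℝ (JetFun U) (JetFun U) :=
  lieDer (fun _ => coordVec I σ) (isJetField_const _)

lemma totDer_apply (i : Fin n) (f : JetFun U) (z : Over U) :
    (totDer U i f).1 z = diff f z (formalDeriv i z.1) := rfl

lemma coordDer_apply (I : Fin n → ℕ) (σ : Fin m) (f : JetFun U) (z : Over U) :
    (coordDer U I σ f).1 z = diff f z (coordVec I σ) := rfl

/-- The second derivative of `f`. -/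
def hess (f : JetFun U) (z : Over U) (v w : Jet n m) : ℝ :=
  fderiv ℝ (fderiv ℝ (rep f)) (truncJet (order f) z.1) (truncJet _ v) (truncJet _ w)

lemma hess_symm (f : JetFun U) (z : Over U) (v w : Jet n m) : hess f z v w = hess f z w v :=
  ((contDiffAt_of_over (rep_spec f).1 z.2).isSymmSndFDerivAt
    (by simp; exact WithTop.coe_le_coe.2 (le_top : (2 : ℕ∞) ≤ ⊤))).eq _ _

/-- The derivative of `W f` in the direction `v` when `w'` is the derivative of `W`. -/
lemma diff_lieDer {W : Jet n m → Jet n m} (hW : IsJetField U W) (f : JetFun U) (z : Over U)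
    {v w' : Jet n m} (h1 : ∀ i, HasLineDerivAt ℝ (fun w => (W w).1 i) (w'.1 i) z.1 v)
    (h2 : ∀ I σ, HasLineDerivAt ℝ (fun w => (W w).2 I σ) (w'.2 I σ) z.1 v) :
    diff (lieDer W hW f) z v = hess f z v (W z.1) + diff f z w' := by
  refine diff_unique _
    (g := fun w => fderiv ℝ (rep f) (truncJet (order f) w) (truncJet (order f) (W w)))
    (fun w h => rfl) ?_
  have h3 : truncJet (order f) (z.1 + (0 : ℝ) • v) = truncJet (order f) z.1 := by simp
  have e1 : HasDerivAt (fun t : ℝ => fderiv ℝ (rep f) (truncJet (order f) (z.1 + t • v)))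
      (fderiv ℝ (fderiv ℝ (rep f)) (truncJet (order f) z.1) (truncJet _ v)) 0 := by
    have := ((contDiffAt_of_over ((rep_spec f).1.fderiv_of_isOpen (isOpen_over U _) (m := ∞)
      (by simp)) z.2).differentiableAt (by simp)).hasFDerivAt
    rw [← h3] at this ⊢
    exact this.comp_hasDerivAt (0 : ℝ) (by simpa using hasDerivAt_truncJet (order f) z.1 v)
  have e2 : HasDerivAt (fun t : ℝ => truncJet (order f) (W (z.1 + t • v)))
      (truncJet (order f) w') 0 := by
    refine HasDerivAt.prodMk (hasDerivAt_pi.2 fun i => h1 i)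
      (hasDerivAt_pi.2 fun I => hasDerivAt_pi.2 fun σ => h2 I.1 σ)
  have := e1.clm_apply e2
  simp only [zero_smul, add_zero] at this
  exact this

lemma hasLineDerivAt_formalDeriv (i : Fin n) (z v : Jet n m) :
    (∀ j, HasLineDerivAt ℝ (fun w : Jet n m => (formalDeriv i w).1 j)
      (Prod.fst ((0, fun I => v.2 (I + Pi.single i 1)) : Jet n m) j) z v) ∧
    ∀ I σ, HasLineDerivAt ℝ (fun w : Jet n m => (formalDeriv i w).2 I σ)
      (Prod.snd ((0, fun I => v.2 (I + Pi.single i 1)) : Jet n m) I σ) z v := by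
  refine ⟨fun j => hasDerivAt_const _ _, fun I σ => ?_⟩
  have := ((hasDerivAt_id (0 : ℝ)).mul_const (v.2 (I + Pi.single i 1) σ)).const_add
    (z.2 (I + Pi.single i 1) σ)
  simpa [HasLineDerivAt, formalDeriv] using this

/-- The second term differentiates the coefficients y^σ_{I+e_i} of d_i itself. -/
lemma diff_totDer (i : Fin n) (f : JetFun U) (z : Over U) (v : Jet n m) :
    diff (totDer U i f) z v = hess f z v (formalDeriv i z.1)
      + diff f z (0, fun I => v.2 (I + Pi.single i 1)) :=
  diff_lieDer _ f z (hasLineDerivAt_formalDeriv i z.1 v).1 (hasLineDerivAt_formalDeriv i z.1 v).2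

lemma diff_coordDer (I : Fin n → ℕ) (σ : Fin m) (f : JetFun U) (z : Over U) (v : Jet n m) :
    diff (coordDer U I σ f) z v = hess f z v (coordVec I σ) := by
  have := diff_lieDer (isJetField_const (U := U) (coordVec I σ)) f z (v := v) (w' := 0)
    (fun j => hasDerivAt_const _ _) (fun I σ => hasDerivAt_const _ _)
  rw [map_zero, add_zero] at this
  exact this

/-- The second derivatives agree by symmetry, and the two correction terms both shift multi-indices
by e_i + e_j. -/
lemma totDer_comm (i j : Fin n) (f : JetFun U) :
    totDer U i (totDer U j f) = totDer U j (totDer U i f) := by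
  refine Subtype.ext (funext fun z => ?_)
  rw [totDer_apply, diff_totDer, totDer_apply, diff_totDer, hess_symm]
  congr 2
  refine Prod.ext rfl ?_
  funext I
  simp [formalDeriv, add_right_comm]

/-- The coefficient of ∂/∂y^σ_I in d_i is y^σ_{I+e_i}, so the commutator of ∂/∂y^σ_{I+e_i} with d_i
is ∂/∂y^σ_I. -/
lemma coordDer_totDer_add (i : Fin n) (I : Fin n → ℕ) (σ : Fin m) (f : JetFun U) :
    coordDer U (I + Pi.single i 1) σ (totDer U i f) =
      totDer U i (coordDer U (I + Pi.single i 1) σ f) + coordDer U I σ f := by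
  refine Subtype.ext (funext fun z => ?_)
  change (coordDer U _ σ (totDer U i f)).1 z =
    (totDer U i (coordDer U _ σ f)).1 z + (coordDer U I σ f).1 z
  rw [coordDer_apply, diff_totDer, totDer_apply, diff_coordDer, coordDer_apply, hess_symm]
  congr 2
  refine Prod.ext rfl ?_
  funext J
  simp [coordVec, Pi.single_apply]

lemma coordDer_totDer_of_eq_zero (i : Fin n) {I : Fin n → ℕ} (hI : I i = 0) (σ : Fin m)
    (f : JetFun U) :
    coordDer U I σ (totDer U i f) = totDer U i (coordDer U I σ f) := by
  refine Subtype.ext (funext fun z => ?_)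
  rw [coordDer_apply, diff_totDer, totDer_apply, diff_coordDer, hess_symm]
  have : ((0, fun J => (coordVec I σ).2 (J + Pi.single i 1)) : Jet n m) = 0 := by
    refine Prod.ext rfl ?_
    funext J
    have : J + Pi.single i 1 ≠ I := fun h => by
      have := congrFun h i; simp at this; omega
    simp [coordVec, this]
  rw [this]; simp

lemma coordDer_eq_zero (f : JetFun U) (I : Fin n → ℕ) (hI : order f < ∑ i, I i) (σ : Fin m) :
    coordDer U I σ f = 0 := by
  refine Subtype.ext (funext fun z => ?_)
  rw [coordDer_apply]
  simp [diff, truncJet_coordVec_eq_zero hI]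

lemma finite_support_coordDer (f : JetFun U) (σ : Fin m) :
    (Function.support fun I => coordDer U I σ f).Finite := by
  refine (Set.finite_range (Subtype.val : MultiIdx n (order f) → _)).subset fun I hI => ?_
  by_contra h
  exact hI (coordDer_eq_zero f I (by by_contra h'; exact h ⟨⟨I, not_lt.1 h'⟩, rfl⟩) σ)

end JetFunctions

/-! ### Integration by parts -/

section IterOp

variable {n : ℕ} {α : Type*} {D : Fin n → α → α}

lemma foldr_iterate_comm (hD : ∀ i j a, D i (D j a) = D j (D i a)) (i : Fin n) (I : Fin n → ℕ)
    (l : List (Fin n)) (a : α) :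
    l.foldr (fun j g => (D j)^[I j] g) (D i a) = D i (l.foldr (fun j g => (D j)^[I j] g) a) := by
  induction l with
  | nil => rfl
  | cons j l ih =>
    rw [List.foldr_cons, List.foldr_cons, ih]
    exact ((Function.Commute.iterate_right (f := D i) (g := D j) (fun a => hD i j a) (I j)) _).symm

lemma iterOp_comm (hD : ∀ i j a, D i (D j a) = D j (D i a)) (i : Fin n) (I : Fin n → ℕ) (a : α) :
    iterOp D I (D i a) = D i (iterOp D I a) :=
  foldr_iterate_comm hD i I _ a

/-- Commutation lets the additional `D i` be moved outside all the other factors; without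
repetitions in the list it occurs only once. -/
lemma foldr_iterate_add_single (hD : ∀ i j a, D i (D j a) = D j (D i a)) (i : Fin n)
    (I : Fin n → ℕ) (l : List (Fin n)) (hl : l.Nodup) (a : α) :
    l.foldr (fun j g => (D j)^[(I + Pi.single i 1 : Fin n → ℕ) j] g) a =
      if i ∈ l then D i (l.foldr (fun j g => (D j)^[I j] g) a)
      else l.foldr (fun j g => (D j)^[I j] g) a := by
  induction l with
  | nil => simp
  | cons j l ih =>
    rw [List.nodup_cons] at hl
    rw [List.foldr_cons, List.foldr_cons, ih hl.2]
    by_cases hij : i = j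
    · subst hij
      simp [hl.1, Function.iterate_succ_apply']
    · have h0 : (I + Pi.single i 1 : Fin n → ℕ) j = I j := by simp [Ne.symm hij]
      rw [h0]
      by_cases hi : i ∈ l
      · simp only [hi, if_true, List.mem_cons, or_true]
        exact ((Function.Commute.iterate_right (f := D i) (g := D j)
          (fun a => hD i j a) (I j)) _).symm
      · simp [hi, hij]

lemma iterOp_add_single (hD : ∀ i j a, D i (D j a) = D j (D i a)) (i : Fin n) (I : Fin n → ℕ)
    (a : α) : iterOp D (I + Pi.single i 1) a = D i (iterOp D I a) := by
  unfold iterOp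
  rw [foldr_iterate_add_single hD i I _ (List.nodup_finRange n) a]
  simp [List.mem_finRange]

lemma iterOp_zero (a : α) : iterOp D 0 a = a := by
  unfold iterOp
  induction List.finRange n with
  | nil => rfl
  | cons j l ih => rw [List.foldr_cons, ih]; rfl

/-- A relation preserved by all `D i` and `D' i` is preserved by their iterates. -/
lemma iterOp_rel {β : Type*} {D' : Fin n → β → β} (r : α → β → Prop)
    (h : ∀ i a b, r a b → r (D i a) (D' i b)) (I : Fin n → ℕ) {a : α} {b : β} (hab : r a b) :
    r (iterOp D I a) (iterOp D' I b) := by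
  unfold iterOp
  induction List.finRange n with
  | nil => exact hab
  | cons j l ih =>
    rw [List.foldr_cons, List.foldr_cons]
    generalize l.foldr (fun j g => (D j)^[I j] g) a = a' at ih ⊢
    generalize l.foldr (fun j g => (D' j)^[I j] g) b = b' at ih ⊢
    generalize I j = k
    induction k with
    | zero => exact ih
    | succ k ihk =>
      rw [Function.iterate_succ_apply', Function.iterate_succ_apply']
      exact h _ _ _ ihk

end IterOp

/-! ### Formal adjoints of symbols over a ring with commuting derivations. -/

section Parts

variable {n : ℕ} {A : Type*} [CommRing A] [Algebra ℝ A] (D : Fin n → Derivation ℝ A A)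

/-- The iterated derivation `D_I`. -/
def iterDer (I : Fin n → ℕ) : A →+ A where
  toFun := iterOp (fun i a => D i a) I
  map_zero' := (iterOp_rel (α := A) (β := A) (D' := fun i a => D i a)
    (fun a _ => a = 0) (fun i a _ h => by simp [h]) I (b := 0) rfl)
  map_add' a b := by
    -- Additivity is a relation among three sequences of iterates, whereas `iterOp_rel` compares
    -- two. Two of them are therefore run together on pairs, and `h1`, `h2` identify the components.
    have := iterOp_rel (α := A) (β := A × A) (D := fun i a => D i a)
      (D' := fun i p => (D i p.1, D i p.2)) (fun a p => a = p.1 + p.2)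
      (fun i a p h => by simp [h]) I (a := a + b) (b := (a, b)) rfl
    have h1 := iterOp_rel (α := A × A) (β := A) (D' := fun i a => D i a)
      (D := fun i p => (D i p.1, D i p.2)) (fun p a => p.1 = a)
      (fun i a p h => by simp [h]) I (a := (a, b)) (b := a) rfl
    have h2 := iterOp_rel (α := A × A) (β := A) (D' := fun i a => D i a)
      (D := fun i p => (D i p.1, D i p.2)) (fun p a => p.2 = a)
      (fun i a p h => by simp [h]) I (a := (a, b)) (b := b) rfl
    rw [this, h1, h2]

/-- The operator on symbols `∑ a_I w_I` induced by `D_i` and `D_i w_I = w_{I + e_i}`. -/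
def symbolDer (i : Fin n) : ((Fin n → ℕ) →₀ A) →+ ((Fin n → ℕ) →₀ A) :=
  Finsupp.liftAddHom fun I =>
    (Finsupp.singleAddHom I).comp ((D i : A →ₗ[ℝ] A).toAddMonoidHom)
      + Finsupp.singleAddHom (I + Pi.single i 1)

lemma symbolDer_single (i : Fin n) (I : Fin n → ℕ) (a : A) :
    symbolDer D i (Finsupp.single I a) =
      Finsupp.single I (D i a) + Finsupp.single (I + Pi.single i 1) a := by
  simp [symbolDer]

/-- The formal adjoint `∑ (-1)^{|I|} D_I a_I` of a symbol. -/
def euler : ((Fin n → ℕ) →₀ A) →+ A :=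
  Finsupp.liftAddHom fun I => ((-1 : ℤ) ^ (∑ i, I i)) • iterDer D I

lemma euler_single (I : Fin n → ℕ) (a : A) :
    euler D (Finsupp.single I a) = ((-1 : ℤ) ^ (∑ i, I i)) • iterDer D I a := by
  simp [euler]

/-- The value `∑ a_I D_I Q` of a symbol. -/
def symbolEval (Q : A) : ((Fin n → ℕ) →₀ A) →+ A :=
  Finsupp.liftAddHom fun I => AddMonoidHom.mulRight (iterDer D I Q)

lemma symbolEval_single (Q : A) (I : Fin n → ℕ) (a : A) :
    symbolEval D Q (Finsupp.single I a) = a * iterDer D I Q := by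
  simp [symbolEval]

lemma iterDer_zero (a : A) : iterDer D 0 a = a := iterOp_zero a

lemma symbolEval_single_zero (Q : A) (a : A) :
    symbolEval D Q (Finsupp.single 0 a) = a * Q := by
  rw [symbolEval_single, iterDer_zero]

variable {D}

lemma iterDer_add_single (hD : ∀ i j a, D i (D j a) = D j (D i a)) (i : Fin n) (I : Fin n → ℕ)
    (a : A) : iterDer D (I + Pi.single i 1) a = D i (iterDer D I a) :=
  iterOp_add_single hD i I a

lemma iterDer_comm (hD : ∀ i j a, D i (D j a) = D j (D i a)) (i : Fin n) (I : Fin n → ℕ)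
    (a : A) : iterDer D I (D i a) = D i (iterDer D I a) :=
  iterOp_comm (D := fun i a => D i a) hD i I a

lemma sum_add_single (i : Fin n) (I : Fin n → ℕ) :
    ∑ j, (I + Pi.single i 1 : Fin n → ℕ) j = ∑ j, I j + 1 := by
  simp [Finset.sum_add_distrib]

/-- On a single term a w_I both contributions are D_I D_i a, with the opposite signs (-1)^{|I|} and
(-1)^{|I|+1}. -/
lemma euler_symbolDer (hD : ∀ i j a, D i (D j a) = D j (D i a)) (i : Fin n)
    (F : (Fin n → ℕ) →₀ A) : euler D (symbolDer D i F) = 0 := by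
  induction F using Finsupp.induction_linear with
  | zero => simp
  | add F G hF hG => rw [map_add, map_add, hF, hG, add_zero]
  | single I a =>
    rw [symbolDer_single, map_add, euler_single, euler_single, sum_add_single,
      iterDer_add_single hD, iterDer_comm hD, pow_succ]
    simp

/-- This is the Leibniz rule for D_i (a D_I Q); it turns formal divergences of symbols into actual
ones. -/
lemma symbolEval_symbolDer (hD : ∀ i j a, D i (D j a) = D j (D i a)) (Q : A) (i : Fin n)
    (F : (Fin n → ℕ) →₀ A) :
    symbolEval D Q (symbolDer D i F) = D i (symbolEval D Q F) := by
  induction F using Finsupp.induction_linear with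
  | zero => simp
  | add F G hF hG => simp only [map_add, hF, hG]
  | single I a =>
    rw [symbolDer_single, map_add, symbolEval_single, symbolEval_single, symbolEval_single,
      iterDer_add_single hD, Derivation.leibniz]
    simp only [smul_eq_mul]
    ring

lemma exists_eq_add_single {i : Fin n} {I : Fin n → ℕ} (hI : I i ≠ 0) :
    ∃ J : Fin n → ℕ, I = J + Pi.single i 1 :=
  ⟨I - Pi.single i 1, funext fun j => by
    by_cases hj : j = i
    · subst hj; simp; omega
    · simp [hj]⟩

/-- Induction on |I|: a w_{J+e_i} = D_i (a w_J) - (D_i a) w_J, where the first term is a divergence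
invisible to `euler` and the second has lower length. -/
lemma exists_parts_single (hD : ∀ i j a, D i (D j a) = D j (D i a)) (k : ℕ) :
    ∀ (I : Fin n → ℕ), ∑ i, I i = k → ∀ a : A, ∃ G : Fin n → (Fin n → ℕ) →₀ A,
      Finsupp.single I a =
        Finsupp.single 0 (euler D (Finsupp.single I a)) + ∑ i, symbolDer D i (G i) := by
  induction k with
  | zero =>
    intro I hI a
    have h0 : I = 0 := funext fun i => by
      have := (Finset.sum_eq_zero_iff.1 hI) i (Finset.mem_univ i)
      simpa using this
    subst h0
    exact ⟨0, by simp [euler_single, iterDer_zero]⟩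
  | succ k ih =>
    intro I hI a
    obtain ⟨i, hi⟩ : ∃ i, I i ≠ 0 := by
      by_contra! h
      simp [h] at hI
    obtain ⟨J, rfl⟩ := exists_eq_add_single hi
    rw [sum_add_single] at hI
    obtain ⟨G, hG⟩ := ih J (by omega) (D i a)
    refine ⟨fun j => (if j = i then Finsupp.single J a else 0) - G j, ?_⟩
    have h1 : ∑ j, symbolDer D j (if j = i then Finsupp.single J a else 0) =
        symbolDer D i (Finsupp.single J a) := by
      rw [Finset.sum_eq_single i (fun j _ hj => by simp [hj]) (by simp)]
      simp
    have h2 : Finsupp.single (J + Pi.single i 1) a =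
        symbolDer D i (Finsupp.single J a) - Finsupp.single J (D i a) := by
      rw [symbolDer_single]; abel
    simp only [map_sub, Finset.sum_sub_distrib, h1]
    rw [h2, map_sub, euler_symbolDer hD, zero_sub, Finsupp.single_neg]
    nth_rewrite 1 [hG]
    abel

/-- Every symbol is its formal adjoint up to a total divergence. -/
lemma exists_parts (hD : ∀ i j a, D i (D j a) = D j (D i a)) (F : (Fin n → ℕ) →₀ A) :
    ∃ G : Fin n → (Fin n → ℕ) →₀ A,
      F = Finsupp.single 0 (euler D F) + ∑ i, symbolDer D i (G i) := by
  induction F using Finsupp.induction_linear with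
  | zero => exact ⟨0, by simp⟩
  | add F F' hF hF' =>
    obtain ⟨G, hG⟩ := hF
    obtain ⟨G', hG'⟩ := hF'
    refine ⟨fun i => G i + G' i, ?_⟩
    simp only [map_add, Finset.sum_add_distrib, Finsupp.single_add]
    nth_rewrite 1 [hG, hG']
    abel
  | single I a => exact exists_parts_single hD _ I rfl a

lemma symbolEval_parts (hD : ∀ i j a, D i (D j a) = D j (D i a)) (Q e : A)
    (G : Fin n → (Fin n → ℕ) →₀ A) :
    symbolEval D Q (Finsupp.single 0 e - ∑ i, symbolDer D i (G i)) =
      e * Q - ∑ i, D i (symbolEval D Q (G i)) := by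
  simp only [map_sub, map_sum, symbolEval_single_zero, symbolEval_symbolDer hD]

/-- The minus sign matches the 1-contact part of the differential of a momentum, which is minus a
divergence (`IsMomentum.source`). -/
lemma exists_parts_sub (hD : ∀ i j a, D i (D j a) = D j (D i a)) (F : (Fin n → ℕ) →₀ A) :
    ∃ G : Fin n → (Fin n → ℕ) →₀ A,
      F = Finsupp.single 0 (euler D F) - ∑ i, symbolDer D i (G i) := by
  obtain ⟨G, hG⟩ := exists_parts hD F
  refine ⟨fun i => -G i, ?_⟩
  simp only [map_neg, Finset.sum_neg_distrib, sub_neg_eq_add]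
  exact hG

/-- The coefficients obey the same recursion as the partial derivatives of d_i f in
`coordDer_totDer_add`; this is what `symbol_totDer` compares. -/
lemma symbolDer_apply_add_single (i : Fin n) (I : Fin n → ℕ) (F : (Fin n → ℕ) →₀ A) :
    symbolDer D i F (I + Pi.single i 1) = D i (F (I + Pi.single i 1)) + F I := by
  induction F using Finsupp.induction_linear with
  | zero => simp
  | add F G hF hG => simp only [map_add, Finsupp.add_apply, hF, hG]; abel
  | single J a =>
    rw [symbolDer_single]
    simp only [Finsupp.add_apply, Finsupp.single_apply, add_left_inj]
    split_ifs <;> simp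

lemma symbolDer_apply_of_eq_zero {i : Fin n} {I : Fin n → ℕ} (hI : I i = 0)
    (F : (Fin n → ℕ) →₀ A) : symbolDer D i F I = D i (F I) := by
  induction F using Finsupp.induction_linear with
  | zero => simp
  | add F G hF hG => simp only [map_add, Finsupp.add_apply, hF, hG]
  | single J a =>
    have h : (J + Pi.single i 1 : Fin n → ℕ) ≠ I := fun h => by
      have := congrFun h i
      simp [hI] at this
    rw [symbolDer_single]
    simp only [Finsupp.add_apply, Finsupp.single_apply, h, if_false, add_zero]
    split_ifs <;> simp

end Parts

/-! ### Alternating forms of top and almost top degree -/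

section TopForms

variable {n : ℕ}

lemma removeNth_succ_cons {E : Type*} {k : ℕ} (j : Fin (k + 1)) (u : E) (v : Fin (k + 1) → E) :
    (Fin.succ j).removeNth (α := fun _ => E) (Fin.cons u v : Fin (k + 2) → E) =
      (Fin.cons u (j.removeNth v) : Fin (k + 1) → E) := by
  funext i
  refine Fin.cases ?_ (fun i => ?_) i
  · simp [Fin.removeNth]
  · simp [Fin.removeNth]

lemma comp_cons {E F : Type*} {k : ℕ} (f : E → F) (u : E) (v : Fin k → E) :
    (fun i => f ((Fin.cons u v : Fin (k + 1) → E) i)) = (Fin.cons (f u) fun i => f (v i)) := by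
  funext i
  refine Fin.cases rfl (fun i => rfl) i

lemma exists_removeNth_eq {E : Type*} {k : ℕ} {i j : Fin (k + 1)} (h : j ≠ i)
    (v : Fin (k + 1) → E) : ∃ a, i.removeNth v a = v j := by
  obtain ⟨a, ha⟩ := Fin.exists_succAbove_eq h
  exact ⟨a, by simp [Fin.removeNth, ha]⟩

/-- The volume form of `ℝⁿ⁺¹`. -/
abbrev volB (n : ℕ) : (Fin (n + 1) → ℝ) [⋀^Fin (n + 1)]→ₗ[ℝ] ℝ := Matrix.detRowAlternating

lemma volB_eq_basis_det : (Pi.basisFun ℝ (Fin (n + 1))).det = volB n := by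
  ext v
  simp only [Module.Basis.det_apply, Matrix.detRowAlternating]
  rw [← Matrix.det_transpose]
  rfl

/-- The standard frame of `ℝⁿ⁺¹`. -/
def stdFrame (n : ℕ) (i : Fin (n + 1)) : Fin (n + 1) → ℝ := Pi.single i 1

lemma stdFrame_eq : stdFrame n = Pi.basisFun ℝ (Fin (n + 1)) := by
  funext i; simp [stdFrame]

lemma volB_stdFrame : volB n (stdFrame n) = 1 := by
  rw [stdFrame_eq, ← volB_eq_basis_det]
  exact Module.Basis.det_self _

lemma top_form_eq (g : (Fin (n + 1) → ℝ) [⋀^Fin (n + 1)]→ₗ[ℝ] ℝ) 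
    (v : Fin (n + 1) → Fin (n + 1) → ℝ) : g v = g (stdFrame n) * volB n v := by
  have h := g.eq_smul_basis_det (Pi.basisFun ℝ (Fin (n + 1)))
  have h' := congrArg (fun f => f v) h
  rw [volB_eq_basis_det] at h'
  rw [stdFrame_eq]
  simpa using h'

/-- The form φ ∧ vol has degree exceeding the dimension, so it vanishes on (u, v). Isolating the
term in which φ receives u gives the identity. -/
lemma cramer_base (φ : (Fin (n + 1) → ℝ) →ₗ[ℝ] ℝ) (u : Fin (n + 1) → ℝ)
    (v : Fin (n + 1) → Fin (n + 1) → ℝ) :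
    ∑ j : Fin (n + 1), (-1 : ℝ) ^ (j : ℕ) * (φ (v j) * volB n (Fin.cons u (j.removeNth v))) =
      φ u * volB n v := by
  have h := (AlternatingMap.alternatizeUncurryFin (φ.smulRight (volB n))).map_linearDependent
    (Fin.cons u v) (fun hli => by
      have := hli.fintype_card_le_finrank
      simp at this)
  rw [AlternatingMap.alternatizeUncurryFin_apply, Fin.sum_univ_succ] at h
  simp only [removeNth_succ_cons, Fin.removeNth_zero, Fin.tail_cons, Fin.cons_zero, Fin.cons_succ,
    LinearMap.smulRight_apply, AlternatingMap.smul_apply, Fin.val_zero, pow_zero, one_smul,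
    Fin.val_succ, smul_eq_mul] at h
  rw [add_eq_zero_iff_eq_neg] at h
  rw [h, ← Finset.sum_neg_distrib]
  refine Finset.sum_congr rfl fun j _ => ?_
  rw [pow_succ]
  simp

/-- The dependence of an alternating form on its first argument. -/
def slotLin {k : ℕ} {E : Type*} [AddCommGroup E] [Module ℝ E] (g : E [⋀^Fin (k + 1)]→ₗ[ℝ] ℝ)
    (u : Fin k → E) : E →ₗ[ℝ] ℝ where
  toFun x := g (Fin.cons x u)
  map_add' x y := g.map_vecCons_add u x y
  map_smul' c x := g.map_vecCons_smul u c x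

lemma slotLin_apply {k : ℕ} {E : Type*} [AddCommGroup E] [Module ℝ E]
    (g : E [⋀^Fin (k + 1)]→ₗ[ℝ] ℝ) (u : Fin k → E) (x : E) :
    slotLin g u x = g (Fin.cons x u) := rfl

lemma cons_removeNth_eq {k : ℕ} {E : Type*} [AddCommGroup E] [Module ℝ E]
    (g : E [⋀^Fin (k + 1)]→ₗ[ℝ] ℝ) (u : Fin (k + 1) → E) (j : Fin (k + 1)) :
    (-1 : ℝ) ^ (j : ℕ) * g (Fin.cons (u j) (j.removeNth u)) = g u := by
  have h := g.neg_one_pow_smul_map_insertNth j (u j) (j.removeNth u)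
  rw [Fin.insertNth_self_removeNth] at h
  have h2 : Matrix.vecCons (u j) (j.removeNth u) = Fin.cons (u j) (j.removeNth u) := rfl
  rw [← h2, ← h]
  rcases Nat.even_or_odd (j : ℕ) with h | h <;> simp [h.neg_one_pow]

/-- Forms of degree one less than the dimension. -/
lemma almost_top_form_eq (g : (Fin (n + 1) → ℝ) [⋀^Fin n]→ₗ[ℝ] ℝ) (u : Fin n → Fin (n + 1) → ℝ) :
    g u = ∑ a : Fin (n + 1), (-1 : ℝ) ^ (a : ℕ) *
      g (a.removeNth (stdFrame n)) * volB n (Fin.cons (stdFrame _ a) u) := by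
  -- θ_a = dx^a ∧ g has top degree, hence is a multiple of the volume form. Contracting θ_a with e_a
  -- and summing over a gives (n + 1) g - n g = g.
  let θ : Fin (n + 1) → (Fin (n + 1) → ℝ) [⋀^Fin (n + 1)]→ₗ[ℝ] ℝ := fun a =>
    AlternatingMap.alternatizeUncurryFin ((LinearMap.proj (R := ℝ) (φ := fun _ => ℝ) a).smulRight g)
  have h1 : ∀ a v, θ a v =
      ∑ j : Fin (n + 1), (-1 : ℝ) ^ (j : ℕ) * (v j a * g (j.removeNth v)) := fun a v => by
    simp only [θ, AlternatingMap.alternatizeUncurryFin_apply, LinearMap.smulRight_apply,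
      AlternatingMap.smul_apply, LinearMap.proj_apply, smul_eq_mul]
    refine Finset.sum_congr rfl fun j _ => ?_
    simp
  have h2 : ∀ a, θ a (stdFrame n) =
      (-1 : ℝ) ^ (a : ℕ) * g (a.removeNth (stdFrame n)) := fun a => by
    rw [h1, Finset.sum_eq_single a (fun j _ hj => by simp [stdFrame, Ne.symm hj]) (by simp)]
    simp [stdFrame]
  have h3 : ∑ a, θ a (Fin.cons (stdFrame _ a) u) = g u := by
    have h9 : ∀ a, θ a (Fin.cons (stdFrame _ a) u) = g u + ∑ j : Fin n, (-1 : ℝ) ^ (j.succ : ℕ) *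
        (u j a * g (j.succ.removeNth (Fin.cons (stdFrame n a) u : Fin (n + 1) → _))) := fun a => by
      rw [h1, Fin.sum_univ_succ]
      simp [stdFrame]
    simp only [h9]
    rw [Finset.sum_add_distrib, Finset.sum_comm]
    have h4 : ∀ j : Fin n, ∑ a : Fin (n + 1), (-1 : ℝ) ^ (j.succ : ℕ) *
        (u j a * g (j.succ.removeNth (Fin.cons (stdFrame _ a) u : Fin (n + 1) → _))) = - g u := by
      obtain _ | k := n
      · exact fun j => j.elim0
      · intro j
        have h5 : (fun a => (-1 : ℝ) ^ (j.succ : ℕ) *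
            (u j a * g (j.succ.removeNth (Fin.cons (stdFrame _ a) u : Fin (k + 1 + 1) → _)))) =
            fun a => -((-1 : ℝ) ^ (j : ℕ) *
              (u j a * g (Fin.cons (stdFrame _ a) (j.removeNth u)))) := by
          funext a
          rw [removeNth_succ_cons, Fin.val_succ, pow_succ]
          ring
        rw [h5, Finset.sum_neg_distrib, ← Finset.mul_sum]
        rw [← cons_removeNth_eq g u j]
        congr 2
        have h6 : u j = ∑ a, u j a • (stdFrame (k + 1) a) := by
          funext i; simp [stdFrame, Finset.sum_apply, Pi.single_apply]
        conv_rhs => rw [h6]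
        have h7 := map_sum (slotLin g (j.removeNth u)) (fun a => u j a • stdFrame (k + 1) a)
          Finset.univ
        simp only [map_smul, slotLin_apply, smul_eq_mul] at h7
        exact h7.symm
    rw [Finset.sum_congr rfl fun j _ => h4 j]
    simp
    ring
  rw [← h3]
  refine Finset.sum_congr rfl fun a _ => ?_
  rw [top_form_eq, h2]

end TopForms

/-! ### Horizontal and contact parts -/

section Splitting

variable {n m : ℕ}

/-- The horizontal lift at `z`. -/
def horLift (z : Jet (n + 1) m) : (Fin (n + 1) → ℝ) →ₗ[ℝ] Jet (n + 1) m where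
  toFun u := ∑ i, u i • formalDeriv i z
  map_add' u v := by simp [add_smul, Finset.sum_add_distrib]
  map_smul' c u := by simp [Finset.smul_sum, smul_smul]

lemma horVec_eq (z v : Jet (n + 1) m) : horVec z v = horLift z v.1 := rfl

lemma horLift_fst (z : Jet (n + 1) m) (u : Fin (n + 1) → ℝ) : (horLift z u).1 = u := by
  funext i
  simp [horLift, Prod.fst_sum, Finset.sum_apply, formalDeriv, Pi.single_apply]

lemma horLift_snd (z : Jet (n + 1) m) (u : Fin (n + 1) → ℝ) (I : Fin (n + 1) → ℕ) (σ : Fin m) :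
    (horLift z u).2 I σ = ∑ i, u i * z.2 (I + Pi.single i 1) σ := by
  simp [horLift, Prod.snd_sum, Finset.sum_apply, formalDeriv]

lemma horLift_stdFrame (z : Jet (n + 1) m) (i : Fin (n + 1)) :
    horLift z (stdFrame n i) = formalDeriv i z := by
  simp [horLift, stdFrame, Pi.single_apply]

lemma conVec_fst (z v : Jet (n + 1) m) : (conVec z v).1 = 0 := by
  simp [conVec, horVec_eq, horLift_fst]

lemma conVec_snd (z v : Jet (n + 1) m) (I : Fin (n + 1) → ℕ) (σ : Fin m) :
    (conVec z v).2 I σ = v.2 I σ - ∑ i, v.1 i * z.2 (I + Pi.single i 1) σ := by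
  simp [conVec, horVec_eq, horLift_snd]

lemma conVec_of_vertical (z : Jet (n + 1) m) {v : Jet (n + 1) m} (hv : v.1 = 0) :
    conVec z v = v := by
  simp [conVec, horVec_eq, hv]

lemma conVec_horLift (z : Jet (n + 1) m) (u : Fin (n + 1) → ℝ) : conVec z (horLift z u) = 0 := by
  simp [conVec, horVec_eq, horLift_fst]

lemma conVec_formalDeriv (z : Jet (n + 1) m) (i : Fin (n + 1)) :
    conVec z (formalDeriv i z) = 0 := by
  rw [← horLift_stdFrame, conVec_horLift]

lemma horVec_add_conVec (z v : Jet (n + 1) m) : horVec z v + conVec z v = v := by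
  simp [conVec]

/-- The volume form `dx⁰ ∧ ⋯ ∧ dxⁿ`. -/
def vol (v : Fin (n + 1) → Jet (n + 1) m) : ℝ := volB n fun i => (v i).1

/-- The form `∂/∂xⁱ ⌋ vol`. -/
def ds (i : Fin (n + 1)) (u : Fin n → Jet (n + 1) m) : ℝ :=
  volB n (Fin.cons (stdFrame n i) fun j => (u j).1)

lemma vol_congr {v w : Fin (n + 1) → Jet (n + 1) m} (h : ∀ i, (v i).1 = (w i).1) :
    vol v = vol w := by
  simp [vol, h]

lemma ds_congr {i : Fin (n + 1)} {v w : Fin n → Jet (n + 1) m} (h : ∀ i, (v i).1 = (w i).1) :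
    ds i v = ds i w := by
  simp [ds, h]

lemma vol_eq_zero {v : Fin (n + 1) → Jet (n + 1) m} {j : Fin (n + 1)} (h : (v j).1 = 0) :
    vol v = 0 :=
  (volB n).map_coord_zero j h

lemma ds_eq_zero (i : Fin (n + 1)) {u : Fin n → Jet (n + 1) m} {j : Fin n} (h : (u j).1 = 0) :
    ds i u = 0 :=
  (volB n).map_coord_zero j.succ (by simpa using h)

lemma vol_cons (X : Jet (n + 1) m) (u : Fin n → Jet (n + 1) m) :
    vol (Fin.cons X u) = ∑ i, X.1 i * ds i u := by
  have h := map_sum (slotLin (volB n) fun j => (u j).1) (fun i => X.1 i • stdFrame n i) Finset.univ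
  have h2 : ∑ i, X.1 i • stdFrame n i = X.1 := by
    funext i; simp [stdFrame, Finset.sum_apply, Pi.single_apply]
  rw [h2] at h
  simp only [map_smul, slotLin_apply, smul_eq_mul] at h
  rw [vol, comp_cons (fun w : Jet (n + 1) m => w.1)]
  exact h

lemma vol_formalDeriv (z : Jet (n + 1) m) : vol (fun i => formalDeriv i z) = 1 :=
  volB_stdFrame

lemma cramer_ds (φ : (Fin (n + 1) → ℝ) →ₗ[ℝ] ℝ) (i : Fin (n + 1))
    (v : Fin (n + 1) → Jet (n + 1) m) :
    ∑ j : Fin (n + 1), (-1 : ℝ) ^ (j : ℕ) * (φ (v j).1 * ds i (j.removeNth v)) =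
      φ (stdFrame n i) * vol v := by
  rw [vol, ← cramer_base φ (stdFrame n i) fun i => (v i).1]
  rfl

lemma pCon_zero {q : ℕ} (α : JForm (n + 1) m q) (z : Jet (n + 1) m) (v : Fin q → Jet (n + 1) m) :
    pCon 0 α z v = α z fun i => horVec z (v i) := by
  simp [pCon]

lemma pCon_one {q : ℕ} (α : JForm (n + 1) m q) (z : Jet (n + 1) m) (v : Fin q → Jet (n + 1) m) :
    pCon 1 α z v = ∑ j, α z fun i => if i = j then conVec z (v i) else horVec z (v i) := by
  simp [pCon, Finset.powersetCard_one, Finset.sum_map]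

lemma removeNth_ite {q : ℕ} (z : Jet (n + 1) m) (v : Fin (q + 1) → Jet (n + 1) m)
    (j : Fin (q + 1)) :
    j.removeNth (fun i => if i = j then conVec z (v i) else horVec z (v i)) =
      fun i => horLift z (j.removeNth v i).1 := by
  funext i
  simp [Fin.removeNth, horVec_eq]

/-- The single contact argument is moved to the front; the remaining arguments are horizontal lifts,
so what is left is an alternating form on the base. -/
lemma pCon_one_alternating {q : ℕ} {α : JForm (n + 1) m (q + 1)} {z : Jet (n + 1) m}
    {A : Jet (n + 1) m [⋀^Fin (q + 1)]→ₗ[ℝ] ℝ} (hA : ∀ v, α z v = A v)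
    (v : Fin (q + 1) → Jet (n + 1) m) :
    pCon 1 α z v = ∑ j : Fin (q + 1), (-1 : ℝ) ^ (j : ℕ) *
      A (Fin.cons (conVec z (v j)) fun i => horLift z (j.removeNth v i).1) := by
  rw [pCon_one]
  refine Finset.sum_congr rfl fun j _ => ?_
  rw [hA, ← cons_removeNth_eq A _ j, removeNth_ite]
  simp

/-- The 1-contact part of a form of degree one more than the dimension of the base. -/
lemma pCon_one_source {α : JForm (n + 1) m (n + 2)} {z : Jet (n + 1) m}
    {A : Jet (n + 1) m [⋀^Fin (n + 2)]→ₗ[ℝ] ℝ} (hA : ∀ v, α z v = A v)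
    (v : Fin (n + 2) → Jet (n + 1) m) :
    pCon 1 α z v = ∑ j : Fin (n + 2), (-1 : ℝ) ^ (j : ℕ) *
      (α z (Fin.cons (conVec z (v j)) fun i => formalDeriv i z) * vol (j.removeNth v)) := by
  rw [pCon_one_alternating hA]
  refine Finset.sum_congr rfl fun j _ => ?_
  have h := top_form_eq ((A.curryLeft (conVec z (v j))).compLinearMap (horLift z))
    (fun i => (j.removeNth v i).1)
  congr 1
  refine h.trans ?_
  rw [hA]
  congr 1
  refine congrArg (fun u => A (Fin.cons (conVec z (v j)) u)) ?_
  funext i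
  exact horLift_stdFrame z i

/-- The 1-contact part of a form of degree the dimension of the base. -/
lemma pCon_one_momentum {α : JForm (n + 1) m (n + 1)} {z : Jet (n + 1) m}
    {A : Jet (n + 1) m [⋀^Fin (n + 1)]→ₗ[ℝ] ℝ} (hA : ∀ v, α z v = A v)
    (v : Fin (n + 1) → Jet (n + 1) m) :
    pCon 1 α z v = ∑ i : Fin (n + 1), ∑ j : Fin (n + 1), (-1 : ℝ) ^ (j : ℕ) *
      ((-1 : ℝ) ^ (i : ℕ) * A (Fin.cons (conVec z (v j)) (i.removeNth fun k => formalDeriv k z)) *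
        ds i (j.removeNth v)) := by
  rw [pCon_one_alternating hA, Finset.sum_comm]
  refine Finset.sum_congr rfl fun j _ => ?_
  have h := almost_top_form_eq ((A.curryLeft (conVec z (v j))).compLinearMap (horLift z))
    (fun i => (j.removeNth v i).1)
  rw [← Finset.mul_sum]
  congr 1
  refine h.trans ?_
  refine Finset.sum_congr rfl fun i _ => ?_
  congr 2
  refine congrArg (fun u => A (Fin.cons (conVec z (v j)) u)) ?_
  funext a
  exact horLift_stdFrame z _

/-- The horizontal part of a form of degree the dimension of the base. -/
lemma pCon_zero_lagrangian {α : JForm (n + 1) m (n + 1)} {z : Jet (n + 1) m}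
    {A : Jet (n + 1) m [⋀^Fin (n + 1)]→ₗ[ℝ] ℝ} (hA : ∀ v, α z v = A v)
    (v : Fin (n + 1) → Jet (n + 1) m) :
    pCon 0 α z v = A (fun i => formalDeriv i z) * vol v := by
  rw [pCon_zero, hA]
  refine (top_form_eq (A.compLinearMap (horLift z)) fun i => (v i).1).trans ?_
  congr 1
  refine congrArg A ?_
  funext i
  exact horLift_stdFrame z i

end Splitting

/-! ### Symbols of contact forms -/

section Symbols

variable {n m : ℕ} {U : Opens (FibCoord (n + 1) m)}

/-- Symbols `∑ a_I w_I` with coefficients in the functions over `U`. -/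
abbrev Symbol (U : Opens (FibCoord (n + 1) m)) : Type := (Fin (n + 1) → ℕ) →₀ JetFun U

/-- The coordinate `y^σ_I` of tangent vectors. -/
def yLin (I : Fin (n + 1) → ℕ) (σ : Fin m) : Jet (n + 1) m →ₗ[ℝ] ℝ where
  toFun w := w.2 I σ
  map_add' _ _ := rfl
  map_smul' _ _ := rfl

/-- The linear form `∑ a_I dy^σ_I` at `z`. -/
def symbolForm (σ : Fin m) (z : Over U) : Symbol U →+ (Jet (n + 1) m →ₗ[ℝ] ℝ) :=
  Finsupp.liftAddHom fun I =>
    { toFun := fun a => a.1 z • yLin I σ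
      map_zero' := by simp
      map_add' := fun a b => by simp [add_smul] }

lemma symbolForm_single (σ : Fin m) (z : Over U) (I : Fin (n + 1) → ℕ) (a : JetFun U)
    (w : Jet (n + 1) m) : symbolForm σ z (Finsupp.single I a) w = a.1 z * w.2 I σ := by
  simp [symbolForm, yLin]

lemma symbolForm_coordVec_self (σ : Fin m) (z : Over U) (F : Symbol U) (I : Fin (n + 1) → ℕ) :
    symbolForm σ z F (coordVec I σ) = (F I).1 z := by
  induction F using Finsupp.induction_linear with
  | zero => simp
  | add F G hF hG => simp [hF, hG]
  | single J a =>
    rw [symbolForm_single]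
    by_cases h : J = I
    · subst h; simp [coordVec]
    · simp [coordVec, h]

lemma symbolForm_coordVec_of_ne {σ τ : Fin m} (h : σ ≠ τ) (z : Over U) (F : Symbol U)
    (I : Fin (n + 1) → ℕ) : symbolForm σ z F (coordVec I τ) = 0 := by
  induction F using Finsupp.induction_linear with
  | zero => simp
  | add F G hF hG => simp [hF, hG]
  | single J a =>
    rw [symbolForm_single]
    by_cases h' : J = I
    · subst h'; simp [coordVec, h]
    · simp [coordVec, h']

/-- The linear form `∑ a^σ_I dy^σ_I` at `z`. -/
def conForm (F : Fin m → Symbol U) (z : Over U) : Jet (n + 1) m →ₗ[ℝ] ℝ :=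
  ∑ σ, symbolForm σ z (F σ)

lemma conForm_apply (F : Fin m → Symbol U) (z : Over U) (w : Jet (n + 1) m) :
    conForm F z w = ∑ σ, symbolForm σ z (F σ) w := by
  simp [conForm]

/-- Coordinate vectors read off the coefficients, which is why a symbol is determined by its form
(`IsSource.unique`). -/
lemma conForm_coordVec (F : Fin m → Symbol U) (z : Over U) (I : Fin (n + 1) → ℕ) (σ : Fin m) :
    conForm F z (coordVec I σ) = (F σ I).1 z := by
  rw [conForm_apply, Finset.sum_eq_single σ
    (fun τ _ h => symbolForm_coordVec_of_ne h z _ _) (by simp), symbolForm_coordVec_self]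

/-- The symbol of the vertical differential of a function. -/
def symbol (f : JetFun U) (σ : Fin m) : Symbol U :=
  Finsupp.ofSupportFinite (fun I => coordDer U I σ f) (finite_support_coordDer f σ)

lemma symbol_apply (f : JetFun U) (σ : Fin m) (I : Fin (n + 1) → ℕ) :
    symbol f σ I = coordDer U I σ f := rfl

lemma symbolForm_eq_sum (σ : Fin m) (z : Over U) (F : Symbol U) {k : ℕ}
    (hF : ∀ I : Fin (n + 1) → ℕ, k < ∑ i, I i → F I = 0) (w : Jet (n + 1) m) :
    symbolForm σ z F w = ∑ I : MultiIdx (n + 1) k, (F I.1).1 z * w.2 I.1 σ := by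
  have h1 : F = ∑ I : MultiIdx (n + 1) k, Finsupp.single I.1 (F I.1) := by
    ext1 J
    rw [Finsupp.finsetSum_apply]
    by_cases hJ : ∑ i, J i ≤ k
    · rw [Finset.sum_eq_single ⟨J, hJ⟩]
      · simp
      · intro I _ hI
        exact Finsupp.single_eq_of_ne' fun h => hI (Subtype.ext h)
      · simp
    · rw [hF J (not_le.1 hJ)]
      refine (Finset.sum_eq_zero fun I _ => ?_).symm
      exact Finsupp.single_eq_of_ne' fun h => hJ (h ▸ I.2)
  conv_lhs => rw [h1, map_sum]
  simp [symbolForm_single]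

/-- A function of finite order depends on finitely many coordinates, so its differential on a
vertical vector is a finite sum of partial derivatives even though the vector may have infinitely
many components. -/
lemma diff_vertical (f : JetFun U) (z : Over U) {w : Jet (n + 1) m} (hw : w.1 = 0) :
    diff f z w = conForm (symbol f) z w := by
  have h := map_truncJet_vertical (k := order f)
    (fderiv ℝ (rep f) (truncJet (order f) z.1)).toLinearMap hw
  refine h.trans ?_
  rw [conForm_apply, Finset.sum_comm]
  refine Finset.sum_congr rfl fun σ _ => ?_
  rw [symbolForm_eq_sum σ z (symbol f σ) (k := order f) fun I hI => coordDer_eq_zero f I hI σ]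
  refine Finset.sum_congr rfl fun I _ => ?_
  rw [mul_comm, symbol_apply, coordDer_apply]
  rfl

/-- The vertical differential intertwines d_i with its action on symbols: this is the commutator of
d_i with ∂/∂y^σ_I, read coefficientwise. -/
lemma symbol_totDer (i : Fin (n + 1)) (f : JetFun U) (σ : Fin m) :
    symbol (totDer U i f) σ = symbolDer (totDer U) i (symbol f σ) := by
  ext1 I
  by_cases hI : I i = 0
  · rw [symbolDer_apply_of_eq_zero hI, symbol_apply, symbol_apply, coordDer_totDer_of_eq_zero i hI]
  · obtain ⟨J, rfl⟩ := exists_eq_add_single hI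
    rw [symbolDer_apply_add_single, symbol_apply, symbol_apply, symbol_apply, coordDer_totDer_add]

lemma symbol_add (f g : JetFun U) (σ : Fin m) : symbol (f + g) σ = symbol f σ + symbol g σ := by
  ext1 I
  rw [Finsupp.add_apply, symbol_apply, symbol_apply, symbol_apply, map_add]

lemma symbol_sum {ι : Type*} (s : Finset ι) (f : ι → JetFun U) (σ : Fin m) :
    symbol (∑ i ∈ s, f i) σ = ∑ i ∈ s, symbol (f i) σ := by
  ext1 I
  simp only [Finsupp.finsetSum_apply, symbol_apply, map_sum]

/-- The function `z ↦ ω^σ_I (x)`. -/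
def omegaFun (U : Opens (FibCoord (n + 1) m)) (I : Fin (n + 1) → ℕ) (σ : Fin m)
    (x : Jet (n + 1) m) : JetFun U :=
  algebraMap ℝ _ (x.2 I σ) - ∑ k, x.1 k • yFun U (I + Pi.single k 1) σ

lemma omegaFun_apply (I : Fin (n + 1) → ℕ) (σ : Fin m) (x : Jet (n + 1) m) (z : Over U) :
    (omegaFun U I σ x).1 z = (conVec z.1 x).2 I σ := by
  rw [conVec_snd]
  have : (omegaFun U I σ x).1 z = x.2 I σ - (∑ k, x.1 k • yFun U (I + Pi.single k 1) σ).1 z := rfl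
  rw [this]
  simp only [AddSubmonoidClass.coe_finsetSum, Finset.sum_apply]
  rfl

lemma omegaFun_vertical (I : Fin (n + 1) → ℕ) (σ : Fin m) {x : Jet (n + 1) m} (hx : x.1 = 0) :
    omegaFun U I σ x = algebraMap ℝ _ (x.2 I σ) := by
  simp [omegaFun, hx]

lemma diff_zero (z : Over U) (t : Jet (n + 1) m) : diff (0 : JetFun U) z t = 0 := by
  have := diff_smul (0 : ℝ) (0 : JetFun U) z t
  simpa using this

lemma diff_sum {ι : Type*} (s : Finset ι) (f : ι → JetFun U) (z : Over U) (t : Jet (n + 1) m) :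
    diff (∑ i ∈ s, f i) z t = ∑ i ∈ s, diff (f i) z t := by
  classical
  induction s using Finset.induction_on with
  | empty => simp [diff_zero]
  | insert a s ha ih => rw [Finset.sum_insert ha, Finset.sum_insert ha, diff_add, ih]

lemma diff_algebraMap (c : ℝ) (z : Over U) (t : Jet (n + 1) m) :
    diff (algebraMap ℝ (JetFun U) c) z t = 0 :=
  diff_unique _ (g := fun _ => c) (fun _ _ => rfl) (hasDerivAt_const _ _)

lemma diff_yFun (I : Fin (n + 1) → ℕ) (σ : Fin m) (z : Over U) (t : Jet (n + 1) m) :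
    diff (yFun U I σ) z t = t.2 I σ := by
  refine diff_unique _ (g := fun w => w.2 I σ) (fun _ _ => rfl) ?_
  have := ((hasDerivAt_id (0 : ℝ)).mul_const (t.2 I σ)).const_add (z.1.2 I σ)
  simpa [HasLineDerivAt] using this

lemma diff_omegaFun (I : Fin (n + 1) → ℕ) (σ : Fin m) (x : Jet (n + 1) m) (z : Over U)
    (t : Jet (n + 1) m) :
    diff (omegaFun U I σ x) z t = - ∑ k, x.1 k * t.2 (I + Pi.single k 1) σ := by
  rw [omegaFun, sub_eq_add_neg, diff_add, diff_algebraMap, ← neg_one_smul ℝ, diff_smul, diff_sum]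
  simp [diff_smul, diff_yFun]

/-- The function `z ↦ ∑ a_I ω^σ_I (x)`. -/
def symbolFun (σ : Fin m) (x : Jet (n + 1) m) : Symbol U →+ JetFun U :=
  Finsupp.liftAddHom fun I => AddMonoidHom.mulRight (omegaFun U I σ x)

lemma symbolFun_single (σ : Fin m) (x : Jet (n + 1) m) (I : Fin (n + 1) → ℕ) (a : JetFun U) :
    symbolFun σ x (Finsupp.single I a) = a * omegaFun U I σ x := by
  simp [symbolFun]

lemma symbolFun_apply (σ : Fin m) (x : Jet (n + 1) m) (F : Symbol U) (z : Over U) :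
    (symbolFun σ x F).1 z = symbolForm σ z F (conVec z.1 x) := by
  induction F using Finsupp.induction_linear with
  | zero => simp
  | add F G hF hG => simp [hF, hG]
  | single I a =>
    rw [symbolFun_single, symbolForm_single, ← omegaFun_apply]
    rfl

/-- The shift `w_I ↦ w_{I + e_k}` of vertical vectors. -/
def shiftVec (k : Fin (n + 1)) (w : Jet (n + 1) m) : Jet (n + 1) m :=
  (0, fun I => w.2 (I + Pi.single k 1))

/-- Since ω^σ_I (x) vanishes at `z`, derivatives of the coefficients a_I drop out. Only the
derivative of ω^σ_I (x) remains, as `x` is fixed while the horizontal space moves with the point. -/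
lemma diff_symbolFun_horizontal (σ : Fin m) (F : Symbol U) (z : Over U) {x : Jet (n + 1) m}
    (hx : conVec z.1 x = 0) (t : Jet (n + 1) m) :
    diff (symbolFun σ x F) z t = - ∑ k, x.1 k * symbolForm σ z F (shiftVec k t) := by
  induction F using Finsupp.induction_linear with
  | zero => simp [diff_zero]
  | add F G hF hG =>
    simp only [map_add, diff_add, hF, hG, LinearMap.add_apply, mul_add, Finset.sum_add_distrib]
    ring
  | single I a =>
    simp only [symbolFun_single, symbolForm_single]
    rw [diff_mul, omegaFun_apply, hx, diff_omegaFun]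
    simp only [Prod.snd_zero, Pi.zero_apply, zero_mul, add_zero, mul_neg, Finset.mul_sum, shiftVec]
    congr 1
    exact Finset.sum_congr rfl fun k _ => by ring

/-- On a fixed vertical vector ω^σ_I is constant, so d_b hits only the coefficients; the shift
supplies the other half of `symbolDer`. -/
lemma diff_symbolFun_vertical (σ : Fin m) (F : Symbol U) (z : Over U) {c : Jet (n + 1) m}
    (hc : c.1 = 0) (b : Fin (n + 1)) :
    diff (symbolFun σ c F) z (formalDeriv b z.1) + symbolForm σ z F (shiftVec b c) =
      symbolForm σ z (symbolDer (totDer U) b F) c := by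
  induction F using Finsupp.induction_linear with
  | zero => simp [diff_zero]
  | add F G hF hG =>
    simp only [map_add, diff_add, ← hF, ← hG, LinearMap.add_apply]
    ring
  | single I a =>
    rw [symbolFun_single, symbolForm_single, symbolDer_single, map_add, LinearMap.add_apply,
      symbolForm_single, symbolForm_single, diff_mul, omegaFun_vertical _ _ hc, diff_algebraMap,
      totDer_apply]
    have : (algebraMap ℝ (JetFun U) (c.2 I σ)).1 z = c.2 I σ := rfl
    rw [this]
    simp only [shiftVec]
    ring

/-- The function `z ↦ ∑ a^σ_I ω^σ_I (x)`. -/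
def conFun (F : Fin m → Symbol U) (x : Jet (n + 1) m) : JetFun U := ∑ σ, symbolFun σ x (F σ)

lemma conFun_apply (F : Fin m → Symbol U) (x : Jet (n + 1) m) (z : Over U) :
    (conFun F x).1 z = conForm F z (conVec z.1 x) := by
  rw [conForm_apply, conFun]
  simp only [AddSubmonoidClass.coe_finsetSum, Finset.sum_apply, symbolFun_apply]

lemma diff_conFun_horizontal (F : Fin m → Symbol U) (z : Over U) {x : Jet (n + 1) m}
    (hx : conVec z.1 x = 0) (t : Jet (n + 1) m) :
    diff (conFun F x) z t = - ∑ k, x.1 k * conForm F z (shiftVec k t) := by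
  simp only [conFun, diff_sum, diff_symbolFun_horizontal _ _ z hx, conForm_apply,
    Finset.mul_sum, Finset.sum_neg_distrib]
  rw [Finset.sum_comm]

lemma diff_conFun_vertical (F : Fin m → Symbol U) (z : Over U) {c : Jet (n + 1) m}
    (hc : c.1 = 0) (b : Fin (n + 1)) :
    diff (conFun F c) z (formalDeriv b z.1) + conForm F z (shiftVec b c) =
      conForm (fun σ => symbolDer (totDer U) b (F σ)) z c := by
  simp only [conFun, diff_sum, conForm_apply, ← diff_symbolFun_vertical _ _ z hc,
    Finset.sum_add_distrib]

end Symbols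

/-! ### Forms over an open set -/

section Forms

variable {n m : ℕ} {U : Opens (FibCoord (n + 1) m)}

/-- `α = f vol` over `U`. -/
def IsVol (α : JForm (n + 1) m (n + 1)) (f : JetFun U) : Prop :=
  ∀ (z : Over U) v, α z.1 v = f.1 z * vol v

/-- `α = ∑ F^σ_I ω^σ_I ∧ vol` over `U`. -/
def IsSource (α : JForm (n + 1) m (n + 2)) (F : Fin m → Symbol U) : Prop :=
  ∀ (z : Over U) v, α z.1 v = ∑ j : Fin (n + 2),
    (-1 : ℝ) ^ (j : ℕ) * (conForm F z (conVec z.1 (v j)) * vol (j.removeNth v))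

/-- `α = ∑ η_i (∂/∂xⁱ ⌋ vol)` over `U`. -/
def IsCurrent (α : JForm (n + 1) m n) (η : Fin (n + 1) → JetFun U) : Prop :=
  ∀ (z : Over U) v, α z.1 v = ∑ i, (η i).1 z * ds i v

/-- `α = ∑ G^{σ,i}_I ω^σ_I ∧ (∂/∂xⁱ ⌋ vol)` over `U`. -/
def IsMomentum (α : JForm (n + 1) m (n + 1)) (G : Fin (n + 1) → Fin m → Symbol U) : Prop :=
  ∀ (z : Over U) v, α z.1 v = ∑ i : Fin (n + 1), ∑ j : Fin (n + 1),
    (-1 : ℝ) ^ (j : ℕ) * (conForm (G i) z (conVec z.1 (v j)) * ds i (j.removeNth v))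

lemma IsVol.extD_apply {α : JForm (n + 1) m (n + 1)} {f : JetFun U} (h : IsVol α f) (z : Over U)
    (v : Fin (n + 2) → Jet (n + 1) m) :
    extD α z.1 v = ∑ j : Fin (n + 2),
      (-1 : ℝ) ^ (j : ℕ) * (diff f z (v j) * vol (j.removeNth v)) := by
  refine Finset.sum_congr rfl fun j _ => ?_
  rw [lineDeriv_eq_diff (vol (j.removeNth v) • f) (fun w hw => by
    rw [h ⟨w, hw⟩, mul_comm]; rfl), diff_smul, mul_comm (vol _)]

/-- A contact vector among the arguments of `vol` gives zero, so in the exterior derivative only the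
term where `f` is differentiated along the contact argument survives. -/
lemma IsVol.source {α : JForm (n + 1) m (n + 1)} {f : JetFun U} (h : IsVol α f) :
    IsSource (pCon 1 (extD α)) (symbol f) := by
  intro z v
  rw [pCon_one]
  refine Finset.sum_congr rfl fun j _ => ?_
  rw [h.extD_apply, Finset.sum_eq_single j]
  · rw [removeNth_ite, if_pos rfl, diff_vertical f z (conVec_fst _ _)]
    congr 2
    exact vol_congr fun i => horLift_fst _ _
  · intro a _ ha
    obtain ⟨b, hb⟩ := exists_removeNth_eq (Ne.symm ha)
      (fun i => if i = j then conVec z.1 (v i) else horVec z.1 (v i))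
    rw [vol_eq_zero (j := b), mul_zero, mul_zero]
    rw [hb, if_pos rfl, conVec_fst]
  · simp

/-- Evaluation of a source form at a vertical vector and the formal derivatives. -/
lemma IsSource.eval {α : JForm (n + 1) m (n + 2)} {F : Fin m → Symbol U} (h : IsSource α F)
    (z : Over U) {c : Jet (n + 1) m} (hc : c.1 = 0) (u : Fin (n + 1) → Jet (n + 1) m) :
    α z.1 (Fin.cons c u) = conForm F z c * vol u := by
  rw [h, Fin.sum_univ_succ, Finset.sum_eq_zero, add_zero]
  · simp [conVec_of_vertical _ hc]
  · intro j _
    obtain ⟨b, hb⟩ := exists_removeNth_eq (Fin.succ_ne_zero j).symm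
      (Fin.cons c u : Fin (n + 2) → Jet (n + 1) m)
    rw [vol_eq_zero (j := b), mul_zero, mul_zero]
    rw [hb]
    exact hc

/-- Evaluation at a coordinate vector followed by the formal derivatives isolates one coefficient.
-/
lemma IsSource.unique {α β : JForm (n + 1) m (n + 2)} {F G : Fin m → Symbol U}
    (hF : IsSource α F) (hG : IsSource β G) (h : ∀ (z : Over U) v, α z.1 v = β z.1 v) : F = G := by
  funext σ
  ext1 I
  refine Subtype.ext (funext fun z => ?_)
  have := h z (Fin.cons (coordVec I σ) fun i => formalDeriv i z.1)
  rw [hF.eval z rfl, hG.eval z rfl, vol_formalDeriv, conForm_coordVec, conForm_coordVec] at this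
  simpa using this

lemma IsSource.contr_vertical {α : JForm (n + 1) m (n + 2)} {F : Fin m → Symbol U}
    (h : IsSource α F) {X : Jet (n + 1) m → Jet (n + 1) m} (hX : ∀ z : Over U, (X z.1).1 = 0)
    {f : JetFun U} (hf : ∀ z : Over U, f.1 z = conForm F z (X z.1)) : IsVol (contr X α) f := by
  intro z v
  rw [hf]
  exact h.eval z (hX z) v

/-- The Lie derivative of `f vol`. -/
lemma IsVol.lieD_apply {α : JForm (n + 1) m (n + 1)} {f : JetFun U} (h : IsVol α f)
    {X : Jet (n + 1) m → Jet (n + 1) m} {ξ : Fin (n + 1) → JetFun U}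
    (hξ : ∀ i (z : Over U), (ξ i).1 z = (X z.1).1 i)
    (hξ' : ∀ i σ, symbol (ξ i) σ = 0) (z : Over U) (v : Fin (n + 1) → Jet (n + 1) m) :
    lieD X α z.1 v = (diff f z (X z.1) + f.1 z * ∑ i, (totDer U i (ξ i)).1 z) * vol v := by
  -- The components ξⁱ have no vertical derivatives, so their differentials depend only on the base
  -- part of a vector.
  let φ : Fin (n + 1) → (Fin (n + 1) → ℝ) →ₗ[ℝ] ℝ := fun i => diff (ξ i) z ∘ₗ horLift z.1
  have hφ : ∀ i t, diff (ξ i) z t = φ i t.1 := fun i t => by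
    conv_lhs => rw [← horVec_add_conVec z.1 t, map_add, diff_vertical _ z (conVec_fst _ _)]
    rw [conForm_apply]
    simp [hξ', φ, horVec_eq]
  have h1 : contr X (extD α) z.1 v = diff f z (X z.1) * vol v - ∑ j : Fin (n + 1),
      (-1 : ℝ) ^ (j : ℕ) * (diff f z (v j) * vol (Fin.cons (X z.1) (j.removeNth v))) := by
    rw [contr, h.extD_apply, Fin.sum_univ_succ, sub_eq_add_neg, ← Finset.sum_neg_distrib]
    simp only [Fin.val_zero, pow_zero, one_mul, Fin.cons_zero, Fin.removeNth_zero, Fin.tail_cons,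
      Fin.cons_succ, removeNth_succ_cons, Fin.val_succ, pow_succ]
    congr 1
    exact Finset.sum_congr rfl fun j _ => by ring
  have h2 : extD (contr X α) z.1 v = ∑ j : Fin (n + 1), (-1 : ℝ) ^ (j : ℕ) *
      (diff f z (v j) * vol (Fin.cons (X z.1) (j.removeNth v)) +
        f.1 z * ∑ i, φ i (v j).1 * ds i (j.removeNth v)) := by
    refine Finset.sum_congr rfl fun j _ => ?_
    rw [lineDeriv_eq_diff (f * ∑ i, ds i (j.removeNth v) • ξ i) (fun w hw => by
      change α w (Fin.cons (X w) (j.removeNth v)) = _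
      rw [h ⟨w, hw⟩, vol_cons]
      simp only [MulMemClass.coe_mul, Pi.mul_apply, AddSubmonoidClass.coe_finsetSum,
        Finset.sum_apply]
      congr 1
      refine Finset.sum_congr rfl fun i _ => ?_
      rw [← hξ i ⟨w, hw⟩, mul_comm]; rfl), diff_mul, diff_sum, vol_cons]
    congr 1
    rw [add_comm, mul_comm (diff f z (v j))]
    simp only [AddSubmonoidClass.coe_finsetSum, Finset.sum_apply, diff_smul, hφ]
    congr 2
    · refine Finset.sum_congr rfl fun i _ => ?_
      rw [← hξ, mul_comm]; rfl
    · exact Finset.sum_congr rfl fun i _ => mul_comm _ _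
  -- The derivatives of ξ assemble into its divergence by the Cramer identity; the terms with the
  -- derivative of `f` along `v j` cancel between `h1` and `h2`.
  have h3 : ∑ j : Fin (n + 1), (-1 : ℝ) ^ (j : ℕ) * (f.1 z * ∑ i, φ i (v j).1 *
      ds i (j.removeNth v)) = f.1 z * (∑ i, (totDer U i (ξ i)).1 z) * vol v := by
    simp only [Finset.mul_sum, Finset.sum_mul]
    rw [Finset.sum_comm]
    refine Finset.sum_congr rfl fun i _ => ?_
    have h4 := cramer_ds (φ i) i v
    have h5 : φ i (stdFrame n i) = (totDer U i (ξ i)).1 z := by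
      simp only [φ, LinearMap.comp_apply, horLift_stdFrame]
      rfl
    rw [h5] at h4
    rw [mul_assoc, ← h4, Finset.mul_sum]
    exact Finset.sum_congr rfl fun j _ => by ring
  rw [lieD, h1, h2]
  simp only [mul_add, Finset.sum_add_distrib] at h3 ⊢
  rw [h3]
  ring

lemma symbol_algebraMap (c : ℝ) (σ : Fin m) : symbol (algebraMap ℝ (JetFun U) c) σ = 0 := by
  ext1 I
  rw [symbol_apply, Derivation.map_algebraMap]
  rfl

lemma IsVol.lieD_formalDeriv {α : JForm (n + 1) m (n + 1)} {f : JetFun U} (h : IsVol α f)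
    (i : Fin (n + 1)) : IsVol (lieD (formalDeriv i) α) (totDer U i f) := by
  intro z v
  rw [h.lieD_apply (ξ := fun j => algebraMap ℝ _ ((Pi.single i 1 : Fin (n + 1) → ℝ) j))
    (fun _ _ => rfl) (fun _ _ => symbol_algebraMap _ _)]
  simp [totDer_apply]

lemma IsVol.iterated {α : JForm (n + 1) m (n + 1)} {f : JetFun U} (h : IsVol α f)
    (I : Fin (n + 1) → ℕ) : IsVol (formD I α) (iterDer (totDer U) I f) :=
  iterOp_rel (D := fun i => lieD (formalDeriv i)) (D' := fun i a => totDer U i a) IsVol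
    (fun i _ _ h => h.lieD_formalDeriv i) I h

/-- Finite support of the symbol identifies its finite sum with the `finsum` in `interiorEuler`. -/
lemma euler_apply (F : Symbol U) (z : Over U) :
    (euler (totDer U) F).1 z =
      ∑ᶠ I : Fin (n + 1) → ℕ, (-1 : ℝ) ^ (∑ i, I i) * (iterDer (totDer U) I (F I)).1 z := by
  rw [finsum_eq_sum_of_support_subset (s := F.support)]
  · simp only [euler, Finsupp.liftAddHom_apply, Finsupp.sum, AddSubmonoidClass.coe_finsetSum,
      Finset.sum_apply]
    refine Finset.sum_congr rfl fun I _ => ?_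
    rcases Nat.even_or_odd (∑ i, I i) with h | h <;> simp [h.neg_one_pow]
  · intro I hI
    rw [Finset.mem_coe, Finsupp.mem_support_iff]
    intro h0
    apply hI
    simp [h0]

lemma conForm_single_zero (E : Fin m → JetFun U) (z : Over U) (w : Jet (n + 1) m) :
    conForm (fun σ => Finsupp.single 0 (E σ)) z w = ∑ σ, (E σ).1 z * w.2 0 σ := by
  simp [conForm_apply, symbolForm_single]

/-- The interior Euler operator on the level of symbols. -/
lemma IsSource.euler {β : JForm (n + 1) m (n + 2)} {F : Fin m → Symbol U}
    (h : IsSource (pCon 1 β) F) :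
    IsSource (interiorEuler β) fun σ => Finsupp.single 0 (euler (totDer U) (F σ)) := by
  have h1 : ∀ I σ, IsVol (contr (fun _ => coordVec I σ) (pCon 1 β)) (F σ I) := fun I σ =>
    h.contr_vertical (fun _ => rfl) fun z => (conForm_coordVec F z I σ).symm
  intro z v
  simp only [interiorEuler, contactWedge, conForm_single_zero]
  rw [Finset.sum_comm]
  refine Finset.sum_congr rfl fun j _ => ?_
  rw [← Finset.mul_sum, Finset.sum_mul]
  congr 1
  refine Finset.sum_congr rfl fun σ _ => ?_
  have h2 : ∀ I, (-1 : ℝ) ^ (∑ i, I i) *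
      formD I (contr (fun _ => coordVec I σ) (pCon 1 β)) z.1 (j.removeNth v) =
      ((-1 : ℝ) ^ (∑ i, I i) * (iterDer (totDer U) I (F σ I)).1 z) * vol (j.removeNth v) :=
    fun I => by rw [(h1 I σ).iterated I z, mul_assoc]
  simp only [h2]
  simp only [← smul_eq_mul (b := vol (j.removeNth v))]
  rw [← finsum_smul, ← euler_apply, smul_eq_mul]
  ring

end Forms

/-! ### Forms of finite order -/

section FiniteOrder

variable {n m q : ℕ} {U : Opens (FibCoord (n + 1) m)}

/-- `α` is over `U` a smooth form of finite order. -/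
def FiniteOrder (U : Opens (FibCoord (n + 1) m)) (α : JForm (n + 1) m q) : Prop :=
  ∃ k, IsJetForm (U : Set (FibCoord (n + 1) m)) k α

lemma isJetForm_restr {k k' : ℕ} (h : k ≤ k') {α : JForm (n + 1) m q}
    (hα : IsJetForm (U : Set (FibCoord (n + 1) m)) k α) :
    IsJetForm (U : Set (FibCoord (n + 1) m)) k' α := by
  obtain ⟨α', h1, h2⟩ := hα
  refine ⟨fun p => ContinuousAlternatingMap.compContinuousLinearMapCLM (restrJet h)
    (α' (restrJet h p)), ?_, fun z hz v => h2 z hz v⟩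
  refine (ContinuousLinearMap.contDiff _).comp_contDiffOn ?_
  exact h1.comp (restrJet h).contDiff.contDiffOn fun p hp => hp

lemma FiniteOrder.congr {α β : JForm (n + 1) m q} (hα : FiniteOrder U α)
    (h : ∀ (z : Over U) v, β z.1 v = α z.1 v) : FiniteOrder U β := by
  obtain ⟨k, α', h1, h2⟩ := hα
  exact ⟨k, α', h1, fun z hz v => (h ⟨z, hz⟩ v).trans (h2 z hz v)⟩

lemma FiniteOrder.add {α β : JForm (n + 1) m q} (hα : FiniteOrder U α) (hβ : FiniteOrder U β) :
    FiniteOrder U (fun z v => α z v + β z v) := by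
  obtain ⟨k, hα⟩ := hα
  obtain ⟨l, hβ⟩ := hβ
  obtain ⟨α', h1, h2⟩ := isJetForm_restr (le_max_left k l) hα
  obtain ⟨β', h3, h4⟩ := isJetForm_restr (le_max_right k l) hβ
  exact ⟨_, fun p => α' p + β' p, h1.add h3, fun z hz v => by
    change α z v + β z v = _
    rw [h2 z hz, h4 z hz]; rfl⟩

lemma FiniteOrder.sum {ι : Type*} (s : Finset ι) {α : ι → JForm (n + 1) m q}
    (hα : ∀ i ∈ s, FiniteOrder U (α i)) : FiniteOrder U (fun z v => ∑ i ∈ s, α i z v) := by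
  classical
  induction s using Finset.induction_on with
  | empty => exact ⟨0, fun _ => 0, contDiffOn_const, fun z hz v => by simp⟩
  | insert a s ha ih =>
    simp only [Finset.sum_insert ha]
    exact (hα a (by simp)).add (ih fun i hi => hα i (by simp [hi]))

lemma FiniteOrder.mul {α : JForm (n + 1) m q} (hα : FiniteOrder U α) (f : JetFun U) :
    FiniteOrder U (fun z v => extend f.1 z * α z v) := by
  obtain ⟨k, hα⟩ := hα
  obtain ⟨l, f', hf⟩ := exists_represents f
  obtain ⟨α', h1, h2⟩ := isJetForm_restr (le_max_left k l) hα
  have hf := hf.restr (le_max_right k l)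
  exact ⟨_, fun p => f' (restrJet (le_max_right k l) p) • α' p, hf.1.smul h1, fun z hz v => by
    change extend f.1 z * α z v = _
    rw [h2 z hz, extend_eq _ _ hz, hf.2 ⟨z, hz⟩]; rfl⟩

lemma FiniteOrder.alternating {α : JForm (n + 1) m q} (hα : FiniteOrder U α) (z : Over U) :
    ∃ A : Jet (n + 1) m [⋀^Fin q]→ₗ[ℝ] ℝ, ∀ v, α z.1 v = A v := by
  obtain ⟨k, α', h1, h2⟩ := hα
  exact ⟨(α' (truncJet k z.1)).toAlternatingMap.compLinearMap (truncLin (n + 1) m k),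
    fun v => h2 z.1 z.2 v⟩

/-- With constant arguments the exterior derivative is the alternatization of the Fréchet derivative
of a representative. Being alternating is what allows its 1-contact part to be computed with the
contact argument in front. -/
lemma FiniteOrder.extD_alternating {α : JForm (n + 1) m q} (hα : FiniteOrder U α) (z : Over U) :
    ∃ A : Jet (n + 1) m [⋀^Fin (q + 1)]→ₗ[ℝ] ℝ, ∀ v, extD α z.1 v = A v := by
  obtain ⟨k, α', h1, h2⟩ := hα
  refine ⟨(ContinuousAlternatingMap.alternatizeUncurryFin
    (fderiv ℝ α' (truncJet k z.1))).toAlternatingMap.compLinearMap (truncLin (n + 1) m k),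
    fun v => ?_⟩
  change _ = ContinuousAlternatingMap.alternatizeUncurryFin
    (fderiv ℝ α' (truncJet k z.1)) fun i => truncJet k (v i)
  rw [ContinuousAlternatingMap.alternatizeUncurryFin_apply]
  refine Finset.sum_congr rfl fun j _ => ?_
  let L : ((FJet (n + 1) m k) [⋀^Fin q]→L[ℝ] ℝ) →L[ℝ] ℝ :=
    ContinuousAlternatingMap.apply ℝ (FJet (n + 1) m k) ℝ
      (fun i => truncJet k (j.removeNth v i))
  have hrep : Represents U k (fun p => L (α' p)) (fun y => α y.1 (j.removeNth v)) :=
    ⟨L.contDiff.comp_contDiffOn h1, fun y => h2 y.1 y.2 _⟩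
  rw [(hrep.hasLineDerivAt (g := fun w => α w (j.removeNth v)) (fun _ _ => rfl) z (v j)).lineDeriv]
  have hd := ((contDiffAt_of_over h1 z.2).differentiableAt (by simp)).hasFDerivAt
  have hLd : fderiv ℝ (fun p => L (α' p)) (truncJet k z.1) =
      L.comp (fderiv ℝ α' (truncJet k z.1)) := (L.hasFDerivAt.comp _ hd).fderiv
  rw [hLd]
  have hL : L (fderiv ℝ α' (truncJet k z.1) (truncJet k (v j))) =
      fderiv ℝ α' (truncJet k z.1) (truncJet k (v j))
        (j.removeNth fun i => truncJet k (v i)) := rfl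
  rcases Nat.even_or_odd (j : ℕ) with h | h <;> simp [h.neg_one_pow, hL]

end FiniteOrder

/-! ### Contact forms of base degree, their exterior derivatives, and currents. -/

section Momenta

variable {n m : ℕ} {U : Opens (FibCoord (n + 1) m)}

/-- The form `∂/∂xⁱ ⌋ vol` on jets of order `k`. -/
def dsForm (m k : ℕ) (i : Fin (n + 1)) : (FJet (n + 1) m k) [⋀^Fin n]→L[ℝ] ℝ :=
  { ((volB n).curryLeft (stdFrame n i)).compLinearMap
      (LinearMap.fst ℝ (Fin (n + 1) → ℝ) (MultiIdx (n + 1) k → Fin m → ℝ)) with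
    cont := by
      change Continuous fun v : Fin n → FJet (n + 1) m k =>
        Matrix.det (Fin.cons (stdFrame n i) fun j => (v j).1)
      refine Continuous.matrix_det ?_
      refine continuous_pi fun a => ?_
      refine Fin.cases ?_ (fun a => ?_) a
      · simpa using continuous_const
      · simp only [Fin.cons_succ]; fun_prop }

/-- The contact form `ω^σ_I ∧ (∂/∂xⁱ ⌋ vol)`. -/
def contactForm (i : Fin (n + 1)) (I : Fin (n + 1) → ℕ) (σ : Fin m) :
    JForm (n + 1) m (n + 1) := fun z v =>
  ∑ j : Fin (n + 1), (-1 : ℝ) ^ (j : ℕ) * ((conVec z (v j)).2 I σ * ds i (j.removeNth v))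

/-- The exterior product of a linear form with `∂/∂xⁱ ⌋ vol`. -/
def wedgeDs {k : ℕ} (i : Fin (n + 1)) (φ : FJet (n + 1) m k →L[ℝ] ℝ) :
    (FJet (n + 1) m k) [⋀^Fin (n + 1)]→L[ℝ] ℝ :=
  ContinuousAlternatingMap.alternatizeUncurryFin (φ.smulRight (dsForm m k i))

lemma wedgeDs_apply {k : ℕ} (i : Fin (n + 1)) (φ : FJet (n + 1) m k →L[ℝ] ℝ)
    (v : Fin (n + 1) → Jet (n + 1) m) :
    wedgeDs i φ (fun j => truncJet k (v j)) =
      ∑ j : Fin (n + 1), (-1 : ℝ) ^ (j : ℕ) * (φ (truncJet k (v j)) * ds i (j.removeNth v)) := by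
  rw [wedgeDs, ContinuousAlternatingMap.alternatizeUncurryFin_apply]
  refine Finset.sum_congr rfl fun j _ => ?_
  have : dsForm m k i (j.removeNth fun i => truncJet k (v i)) = ds i (j.removeNth v) := rfl
  rcases Nat.even_or_odd (j : ℕ) with h | h <;> simp [h.neg_one_pow, this]

lemma finiteOrder_contactForm (i : Fin (n + 1)) (I : Fin (n + 1) → ℕ) (σ : Fin m) :
    FiniteOrder U (contactForm i I σ) := by
  -- One order above |I|, because ω^σ_I involves y^σ_{I+e_b}.
  let k := ∑ a, I a + 1
  let I0 : MultiIdx (n + 1) k := ⟨I, Nat.le_succ _⟩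
  let I1 : Fin (n + 1) → MultiIdx (n + 1) k := fun b =>
    ⟨I + Pi.single b 1, (sum_add_single b I).le⟩
  let φ : FJet (n + 1) m k →L[ℝ] ℝ :=
    (ContinuousLinearMap.proj (R := ℝ) (φ := fun _ => ℝ) σ).comp
      ((ContinuousLinearMap.proj (R := ℝ) (φ := fun _ => Fin m → ℝ) I0).comp
        (ContinuousLinearMap.snd ℝ _ _))
  let χ : Fin (n + 1) → FJet (n + 1) m k →L[ℝ] ℝ := fun b =>
    (ContinuousLinearMap.proj (R := ℝ) (φ := fun _ => ℝ) b).comp (ContinuousLinearMap.fst ℝ _ _)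
  refine ⟨k, fun p => wedgeDs i φ - ∑ b, p.2 (I1 b) σ • wedgeDs i (χ b), by fun_prop,
    fun z _ v => ?_⟩
  rw [ContinuousAlternatingMap.sub_apply, ContinuousAlternatingMap.sum_apply]
  simp only [ContinuousAlternatingMap.smul_apply, wedgeDs_apply, contactForm, conVec_snd,
    smul_eq_mul, sub_mul, mul_sub, Finset.sum_sub_distrib]
  congr 1
  simp only [Finset.sum_mul, Finset.mul_sum]
  rw [Finset.sum_comm]
  refine Finset.sum_congr rfl fun b _ => Finset.sum_congr rfl fun j _ => ?_
  have h1 : χ b (truncJet k (v j)) = (v j).1 b := rfl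
  have h2 : (truncJet k z).2 (I1 b) σ = z.2 (I + Pi.single b 1) σ := rfl
  rw [h1, h2]
  ring

/-- The form `∑ G^{σ,i}_I ω^σ_I ∧ (∂/∂xⁱ ⌋ vol)`. -/
def momentumForm (G : Fin (n + 1) → Fin m → Symbol U) : JForm (n + 1) m (n + 1) := fun z v =>
  ∑ i, ∑ σ, ∑ I ∈ (G i σ).support, extend (G i σ I).1 z * contactForm i I σ z v

lemma finiteOrder_momentumForm (G : Fin (n + 1) → Fin m → Symbol U) :
    FiniteOrder U (momentumForm G) :=
  FiniteOrder.sum _ fun _ _ => FiniteOrder.sum _ fun _ _ => FiniteOrder.sum _ fun _ _ =>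
    (finiteOrder_contactForm _ _ _).mul _

lemma symbolForm_eq_sum_support (σ : Fin m) (z : Over U) (F : Symbol U) (w : Jet (n + 1) m) :
    symbolForm σ z F w = ∑ I ∈ F.support, (F I).1 z * w.2 I σ := by
  simp [symbolForm, Finsupp.sum, yLin]

lemma symbolForm_neg (σ : Fin m) (z : Over U) (F : Symbol U) :
    symbolForm σ z (-F) = -symbolForm σ z F :=
  map_neg (symbolForm σ z) F

lemma isMomentum_momentumForm (G : Fin (n + 1) → Fin m → Symbol U) :
    IsMomentum (momentumForm G) G := by
  intro z v
  refine Finset.sum_congr rfl fun i _ => ?_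
  simp only [conForm_apply, symbolForm_eq_sum_support, contactForm, extend_eq _ _ z.2,
    Finset.mul_sum, Finset.sum_mul]
  refine Eq.symm (Finset.sum_comm.trans (Finset.sum_congr rfl fun σ _ =>
    Finset.sum_comm.trans (Finset.sum_congr rfl fun I _ => Finset.sum_congr rfl fun j _ => ?_)))
  ring

lemma IsMomentum.finiteOrder {β : JForm (n + 1) m (n + 1)} {G : Fin (n + 1) → Fin m → Symbol U}
    (h : IsMomentum β G) : FiniteOrder U β :=
  (finiteOrder_momentumForm G).congr fun z v =>
    (h z v).trans (isMomentum_momentumForm G z v).symm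

lemma IsMomentum.horiz_eq_zero {β : JForm (n + 1) m (n + 1)}
    {G : Fin (n + 1) → Fin m → Symbol U} (h : IsMomentum β G) (z : Over U)
    (v : Fin (n + 1) → Jet (n + 1) m) : horiz β z.1 v = 0 := by
  rw [horiz, pCon_zero, h]
  simp [horVec_eq, conVec_horLift]

lemma IsMomentum.pCon_one {β : JForm (n + 1) m (n + 1)} {G : Fin (n + 1) → Fin m → Symbol U}
    (h : IsMomentum β G) : IsMomentum (pCon 1 β) G := by
  intro z v
  rw [JetVariation.pCon_one]
  simp only [h z]
  rw [Finset.sum_comm]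
  refine Finset.sum_congr rfl fun i _ => Finset.sum_congr rfl fun j _ => ?_
  rw [Finset.sum_eq_single j]
  · rw [removeNth_ite, if_pos rfl, conVec_of_vertical _ (conVec_fst _ _)]
    congr 2
    exact ds_congr fun a => horLift_fst _ _
  · intro a _ ha
    simp [ha, horVec_eq, conVec_horLift]
  · simp

lemma IsMomentum.lineDeriv_eq {β : JForm (n + 1) m (n + 1)} {G : Fin (n + 1) → Fin m → Symbol U}
    (h : IsMomentum β G) (z : Over U) (u : Fin (n + 1) → Jet (n + 1) m) (t : Jet (n + 1) m) :
    lineDeriv ℝ (fun w => β w u) z.1 t = ∑ i : Fin (n + 1), ∑ j : Fin (n + 1),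
      (-1 : ℝ) ^ (j : ℕ) * (diff (conFun (G i) (u j)) z t * ds i (j.removeNth u)) := by
  rw [lineDeriv_eq_diff (∑ i : Fin (n + 1), ∑ j : Fin (n + 1),
    ((-1 : ℝ) ^ (j : ℕ) * ds i (j.removeNth u)) • conFun (G i) (u j)) (fun w hw => by
      rw [h ⟨w, hw⟩]
      simp only [AddSubmonoidClass.coe_finsetSum, Finset.sum_apply]
      refine Finset.sum_congr rfl fun i _ => Finset.sum_congr rfl fun j _ => ?_
      rw [← conFun_apply (G i) (u j) ⟨w, hw⟩, mul_comm (((conFun (G i) (u j)).1 ⟨w, hw⟩)),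
        ← mul_assoc]
      rfl)]
  simp only [diff_sum, diff_smul]
  refine Finset.sum_congr rfl fun i _ => Finset.sum_congr rfl fun j _ => by ring

/-- The exterior derivative of a momentum on a vertical vector and the formal derivatives. -/
lemma IsMomentum.extD_eval {β : JForm (n + 1) m (n + 1)} {G : Fin (n + 1) → Fin m → Symbol U}
    (h : IsMomentum β G) (z : Over U) {c : Jet (n + 1) m} (hc : c.1 = 0) :
    extD β z.1 (Fin.cons c fun i => formalDeriv i z.1) =
      conForm (fun σ => -∑ i, symbolDer (totDer U) i (G i σ)) z c := by
  -- The formal derivatives are frozen at `z`. At `z` the contact forms vanish on them, but the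
  -- derivative of ω^σ_I (e_j) along `c` is -c^σ_{I+e_j}; this produces the shifts in `h0`.
  let e : Fin (n + 1) → Jet (n + 1) m := fun i => formalDeriv i z.1
  have h0 : lineDeriv ℝ (fun w => β w e) z.1 c = -∑ i, conForm (G i) z (shiftVec i c) := by
    rw [h.lineDeriv_eq, ← Finset.sum_neg_distrib]
    refine Finset.sum_congr rfl fun i _ => ?_
    let φ : (Fin (n + 1) → ℝ) →ₗ[ℝ] ℝ :=
      -∑ k, conForm (G i) z (shiftVec k c) • LinearMap.proj (R := ℝ) (φ := fun _ => ℝ) k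
    have hφ : ∀ u, φ u = -∑ k, u k * conForm (G i) z (shiftVec k c) := fun u => by
      simp [φ, mul_comm]
    have h1 := cramer_ds φ i e
    rw [show vol e = 1 from vol_formalDeriv z.1, mul_one] at h1
    have h2 : φ (stdFrame n i) = -conForm (G i) z (shiftVec i c) := by
      simp [hφ, stdFrame, Pi.single_apply]
    rw [← h2, ← h1]
    refine Finset.sum_congr rfl fun j _ => ?_
    rw [diff_conFun_horizontal (G i) z (conVec_formalDeriv z.1 j), ← hφ]
  have h3 : ∀ b : Fin (n + 1), lineDeriv ℝ (fun w => β w (Fin.cons c (b.removeNth e))) z.1 (e b) =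
      ∑ i, diff (conFun (G i) c) z (formalDeriv b z.1) * ds i (b.removeNth e) := fun b => by
    rw [h.lineDeriv_eq]
    refine Finset.sum_congr rfl fun i _ => ?_
    rw [Fin.sum_univ_succ, Finset.sum_eq_zero, add_zero]
    · simp [e]
    · intro j _
      obtain ⟨a, ha⟩ := exists_removeNth_eq (Fin.succ_ne_zero j).symm
        (Fin.cons c (b.removeNth e) : Fin (n + 1) → Jet (n + 1) m)
      rw [ds_eq_zero i (j := a), mul_zero, mul_zero]
      rw [ha]
      exact hc
  -- The sum over `b` collapses to the diagonal by the Cramer identity, leaving a divergence.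
  have h4 : ∑ b : Fin (n + 1), (-1 : ℝ) ^ (b : ℕ) *
      ∑ i, diff (conFun (G i) c) z (formalDeriv b z.1) * ds i (b.removeNth e) =
      ∑ i, diff (conFun (G i) c) z (formalDeriv i z.1) := by
    simp only [Finset.mul_sum]
    rw [Finset.sum_comm]
    refine Finset.sum_congr rfl fun i _ => ?_
    have h1 := cramer_ds (diff (conFun (G i) c) z ∘ₗ horLift z.1) i e
    rw [show vol e = 1 from vol_formalDeriv z.1, mul_one] at h1
    simp only [LinearMap.comp_apply, horLift_stdFrame] at h1
    rw [← h1]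
    refine Finset.sum_congr rfl fun b _ => ?_
    rw [show (e b).1 = stdFrame n b from rfl, horLift_stdFrame]
  have h5 : extD β z.1 (Fin.cons c e) = lineDeriv ℝ (fun w => β w e) z.1 c -
      ∑ b : Fin (n + 1), (-1 : ℝ) ^ (b : ℕ) *
        lineDeriv ℝ (fun w => β w (Fin.cons c (b.removeNth e))) z.1 (e b) := by
    rw [extD, Fin.sum_univ_succ, sub_eq_add_neg, ← Finset.sum_neg_distrib]
    simp only [Fin.val_zero, pow_zero, one_mul, Fin.cons_zero, Fin.removeNth_zero, Fin.tail_cons,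
      Fin.cons_succ, removeNth_succ_cons, Fin.val_succ, pow_succ]
    congr 1
    exact Finset.sum_congr rfl fun j _ => by ring
  rw [h5, h0]
  simp only [h3]
  rw [h4]
  have h6 : conForm (fun σ => -∑ i, symbolDer (totDer U) i (G i σ)) z c =
      -∑ i, conForm (fun σ => symbolDer (totDer U) i (G i σ)) z c := by
    simp only [conForm_apply, symbolForm_neg, map_sum, LinearMap.neg_apply, LinearMap.sum_apply,
      Finset.sum_neg_distrib]
    rw [Finset.sum_comm]
  rw [h6]
  simp only [← diff_conFun_vertical _ z hc, Finset.sum_add_distrib]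
  ring

lemma IsMomentum.source {β : JForm (n + 1) m (n + 1)} {G : Fin (n + 1) → Fin m → Symbol U}
    (h : IsMomentum β G) :
    IsSource (pCon 1 (extD β)) fun σ => -∑ i, symbolDer (totDer U) i (G i σ) := by
  intro z v
  obtain ⟨A, hA⟩ := h.finiteOrder.extD_alternating z
  rw [pCon_one_source hA]
  refine Finset.sum_congr rfl fun j _ => ?_
  rw [h.extD_eval z (conVec_fst _ _)]

/-- The 1-contact part of a form of degree the dimension of the base is a momentum. -/
lemma FiniteOrder.exists_momentum {R : JForm (n + 1) m (n + 1)} (hR : FiniteOrder U R) :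
    ∃ G : Fin (n + 1) → Fin m → Symbol U, IsMomentum (pCon 1 R) G := by
  have halt := hR.alternating
  obtain ⟨k, α', h1, h2⟩ := hR
  -- The coefficient G^{σ,i}_I is, up to the sign (-1)^i, the value of `R` on ∂/∂y^σ_I followed by
  -- all formal derivatives except d_i.
  let W : Fin (n + 1) → (Fin (n + 1) → ℕ) → Fin m → Fin (n + 1) → Jet (n + 1) m → Jet (n + 1) m :=
    fun i I σ => Fin.cons (fun _ => coordVec I σ) (i.removeNth fun a z => formalDeriv a z)
  have hW : ∀ i I σ j, IsJetField U (W i I σ j) := fun i I σ j => by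
    refine Fin.cases ?_ (fun j => ?_) j
    · exact isJetField_const _
    · exact isJetField_formalDeriv _
  choose g hg using fun i I σ => exists_jetFun_alternating h1 (hW i I σ)
  refine ⟨fun i σ => ∑ I : MultiIdx (n + 1) k,
    Finsupp.single I.1 ((-1 : ℝ) ^ (i : ℕ) • g i I.1 σ), fun z v => ?_⟩
  obtain ⟨A, hA⟩ := halt z
  rw [pCon_one_momentum hA]
  refine Finset.sum_congr rfl fun i _ => Finset.sum_congr rfl fun j _ => ?_
  congr 2
  rw [← hA, h2 z.1 z.2]
  have h3 := map_truncJet_vertical (k := k) (slotLin (α' (truncJet k z.1)).toAlternatingMap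
    (fun a => truncJet k (i.removeNth (fun k => formalDeriv k z.1) a))) (conVec_fst z.1 (v j))
  have h4 : ∀ w : Jet (n + 1) m, slotLin (α' (truncJet k z.1)).toAlternatingMap
      (fun a => truncJet k (i.removeNth (fun k => formalDeriv k z.1) a)) (truncJet k w) =
      α' (truncJet k z.1) (fun a => truncJet k ((Fin.cons w
        (i.removeNth fun k => formalDeriv k z.1) : Fin (n + 1) → Jet (n + 1) m) a)) := fun w => by
    rw [comp_cons (truncJet k)]; rfl
  rw [h4] at h3
  refine (congrArg _ h3).trans ?_
  simp only [h4, conForm_apply, map_sum, LinearMap.sum_apply, symbolForm_single]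
  rw [Finset.sum_comm, Finset.mul_sum]
  refine Finset.sum_congr rfl fun σ _ => ?_
  rw [Finset.mul_sum]
  refine Finset.sum_congr rfl fun I _ => ?_
  have h5 : (((-1 : ℝ) ^ (i : ℕ) • g i I.1 σ : JetFun U)).1 z =
      (-1 : ℝ) ^ (i : ℕ) * (g i I.1 σ).1 z := rfl
  rw [h5, hg]
  have h6 : (fun j => truncJet k (W i I.1 σ j z.1)) = fun a => truncJet k ((Fin.cons (coordVec I σ)
        (i.removeNth fun k => formalDeriv k z.1) : Fin (n + 1) → Jet (n + 1) m) a) := by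
    funext a
    refine Fin.cases rfl (fun a => rfl) a
  rw [h6]
  ring

/-- The horizontal differential of a current. -/
lemma IsCurrent.isVol_dH {α : JForm (n + 1) m n} {η : Fin (n + 1) → JetFun U} (h : IsCurrent α η) :
    IsVol (dH α) (∑ i, totDer U i (η i)) := by
  -- A contact argument annihilates `ds`, so only the horizontal component contributes to `dH`.
  have hpos : ∀ l ≠ 0, ∀ (z : Over U) v, pCon l α z.1 v = 0 := fun l hl z v => by
    refine Finset.sum_eq_zero fun S hS => ?_
    rw [Finset.mem_powersetCard] at hS
    obtain ⟨a, ha⟩ : S.Nonempty := Finset.card_pos.1 (by omega)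
    rw [h]
    refine Finset.sum_eq_zero fun i _ => ?_
    rw [ds_eq_zero i (j := a), mul_zero]
    rw [if_pos ha, conVec_fst]
  have h0 : IsCurrent (pCon 0 α) η := fun z v => by
    rw [pCon_zero, h]
    refine Finset.sum_congr rfl fun i _ => ?_
    congr 1
    exact ds_congr fun a => horLift_fst _ _
  intro z v
  have hz : ∀ l ∈ Finset.range (n + 1), l ≠ 0 → pCon l (extD (pCon l α)) z.1 v = 0 :=
    fun l _ hl => by
      refine Finset.sum_eq_zero fun S _ => Finset.sum_eq_zero fun j _ => ?_
      rw [lineDeriv_congr_over (h := fun _ => 0) z.2 fun w hw => hpos l hl ⟨w, hw⟩ _]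
      simp [lineDeriv]
  rw [dH, Finset.sum_eq_single 0 hz (by simp), pCon_zero, extD]
  have h1 : ∀ (u : Fin n → Jet (n + 1) m) (t : Jet (n + 1) m),
      lineDeriv ℝ (fun w => pCon 0 α w u) z.1 t = ∑ i, diff (η i) z t * ds i u := fun u t => by
    rw [lineDeriv_eq_diff (∑ i, ds i u • η i) (fun w hw => by
      rw [h0 ⟨w, hw⟩]
      simp only [AddSubmonoidClass.coe_finsetSum, Finset.sum_apply]
      exact Finset.sum_congr rfl fun i _ => mul_comm _ _), diff_sum]
    exact Finset.sum_congr rfl fun i _ => by rw [diff_smul, mul_comm]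
  simp only [h1, AddSubmonoidClass.coe_finsetSum, Finset.sum_apply, Finset.sum_mul, Finset.mul_sum]
  rw [Finset.sum_comm]
  refine Finset.sum_congr rfl fun i _ => ?_
  have h2 := cramer_ds (diff (η i) z ∘ₗ horLift z.1) i v
  simp only [LinearMap.comp_apply, horLift_stdFrame] at h2
  refine Eq.trans ?_ h2
  refine Finset.sum_congr rfl fun j _ => ?_
  congr 2
  exact ds_congr fun a => horLift_fst _ _

end Momenta

/-! ### Projectable fields and the first variation formula -/

section Fields

variable {n m : ℕ} {U : Opens (FibCoord (n + 1) m)}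

/-- Smooth projectable vector fields over `U`. -/
structure ProjectableOn (U : Opens (FibCoord (n + 1) m))
    (X : FibCoord (n + 1) m → FibCoord (n + 1) m) : Prop where
  smooth : ContDiffOn ℝ ∞ X U
  proj : ∀ p ∈ U, ∀ p' ∈ U, p.1 = p'.1 → (X p).1 = (X p').1

variable {X : FibCoord (n + 1) m → FibCoord (n + 1) m}

lemma contDiffOn_comp_fjetBase (hX : ContDiffOn ℝ ∞ X U) (k : ℕ) :
    ContDiffOn ℝ ∞ (fun p : FJet (n + 1) m k => X (fjetBase p)) {p | fjetBase p ∈ U} := by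
  refine hX.comp (f := fun p : FJet (n + 1) m k => fjetBase p) ?_ fun p hp => hp
  unfold fjetBase
  fun_prop

/-- The component `ξⁱ` of a projectable field. -/
def horComp (hX : ProjectableOn U X) (i : Fin (n + 1)) : JetFun U :=
  ⟨fun z => (X (jetBase z.1)).1 i, 0, fun p => (X (fjetBase p)).1 i,
    contDiffOn_pi.1 (contDiffOn_comp_fjetBase hX.smooth 0).fst i, fun _ => rfl⟩

/-- The component `Ξ^σ` of a projectable field. -/
def verComp (hX : ProjectableOn U X) (σ : Fin m) : JetFun U :=
  ⟨fun z => (X (jetBase z.1)).2 σ, 0, fun p => (X (fjetBase p)).2 σ,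
    contDiffOn_pi.1 (contDiffOn_comp_fjetBase hX.smooth 0).snd σ, fun _ => rfl⟩

/-- The characteristic `Ξ^σ - y^σ_i ξⁱ`. -/
def characteristic (hX : ProjectableOn U X) (σ : Fin m) : JetFun U :=
  verComp hX σ - ∑ i, yFun U (Pi.single i 1) σ * horComp hX i

lemma characteristic_apply (hX : ProjectableOn U X) (σ : Fin m) (z : Over U) :
    (characteristic hX σ).1 z =
      (X (jetBase z.1)).2 σ - ∑ i, z.1.2 (Pi.single i 1) σ * (X (jetBase z.1)).1 i := by
  have : (characteristic hX σ).1 z = (verComp hX σ).1 z -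
      (∑ i, yFun U (Pi.single i 1) σ * horComp hX i : JetFun U).1 z := rfl
  rw [this]
  simp only [AddSubmonoidClass.coe_finsetSum, Finset.sum_apply]
  rfl

/-- Projectability enters here: ξⁱ is constant along every vertical line as long as the line stays
over `U`. -/
lemma symbol_horComp (hX : ProjectableOn U X) (i : Fin (n + 1)) (σ : Fin m) :
    symbol (horComp hX i) σ = 0 := by
  ext1 I
  refine Subtype.ext (funext fun z => ?_)
  rw [symbol_apply, coordDer_apply]
  refine diff_unique _ (g := fun w => (X (jetBase w)).1 i) (fun _ _ => rfl) ?_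
  refine (hasDerivAt_const (0 : ℝ) ((X (jetBase z.1)).1 i)).congr_of_eventuallyEq ?_
  filter_upwards [eventually_jetBase_mem U z.2 (coordVec I σ)] with t ht
  refine congrFun (hX.proj _ ht _ z.2 ?_) i
  funext j
  simp [jetBase, coordVec]

lemma prolong_fst (X : FibCoord (n + 1) m → FibCoord (n + 1) m) (z : Jet (n + 1) m) :
    (prolong X z).1 = (X (jetBase z)).1 := rfl

/-- The summand y^σ_{Ii} ξⁱ of the prolongation is exactly its horizontal part, which leaves d_I of
the characteristic. -/
lemma conVec_prolong_snd (hX : ProjectableOn U X) (z : Over U) (I : Fin (n + 1) → ℕ)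
    (σ : Fin m) :
    (conVec z.1 (prolong X z.1)).2 I σ = (iterDer (totDer U) I (characteristic hX σ)).1 z := by
  have h : ∀ z : Over U, iterOp totD I (fun w => (X (jetBase w)).2 σ -
      ∑ i, w.2 (Pi.single i 1) σ * (X (jetBase w)).1 i) z.1 =
      (iterDer (totDer U) I (characteristic hX σ)).1 z :=
    iterOp_rel (D := totD) (D' := fun i a => totDer U i a)
      (fun g f => ∀ z : Over U, g z.1 = f.1 z)
      (fun i g f hgf z => lineDeriv_eq_diff f (fun w hw => hgf ⟨w, hw⟩) z _) I
      fun z => (characteristic_apply hX σ z).symm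
  rw [conVec_snd, prolong_fst, ← h z]
  simp only [prolong]
  rw [add_sub_assoc]
  exact add_eq_left.2 (sub_eq_zero.2 (Finset.sum_congr rfl fun i _ => mul_comm _ _))

lemma symbolForm_conVec_prolong (hX : ProjectableOn U X) (σ : Fin m) (F : Symbol U) (z : Over U) :
    symbolForm σ z F (conVec z.1 (prolong X z.1)) =
      (symbolEval (totDer U) (characteristic hX σ) F).1 z := by
  induction F using Finsupp.induction_linear with
  | zero => simp
  | add F G hF hG => simp [hF, hG]
  | single I a =>
    rw [symbolForm_single, symbolEval_single, conVec_prolong_snd hX]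
    rfl

/-- The value of a symbol on the characteristics of a field. -/
def evalChar (hX : ProjectableOn U X) (F : Fin m → Symbol U) : JetFun U :=
  ∑ σ, symbolEval (totDer U) (characteristic hX σ) (F σ)

lemma conForm_conVec_prolong (hX : ProjectableOn U X) (F : Fin m → Symbol U) (z : Over U) :
    conForm F z (conVec z.1 (prolong X z.1)) = (evalChar hX F).1 z := by
  rw [conForm_apply, evalChar]
  simp only [symbolForm_conVec_prolong hX, AddSubmonoidClass.coe_finsetSum, Finset.sum_apply]

lemma evalChar_single_zero (hX : ProjectableOn U X) (E : Fin m → JetFun U) :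
    evalChar hX (fun σ => Finsupp.single 0 (E σ)) = ∑ σ, E σ * characteristic hX σ := by
  simp only [evalChar, symbolEval_single_zero]

/-- The coefficient of the Lie derivative of `f vol`. -/
def lieCoeff (hX : ProjectableOn U X) (f : JetFun U) : JetFun U :=
  evalChar hX (symbol f) + ∑ i, totDer U i (horComp hX i * f)

lemma horVec_prolong (z : Jet (n + 1) m) :
    horVec z (prolong X z) = ∑ i, (X (jetBase z)).1 i • formalDeriv i z := rfl

/-- The horizontal part of the field contributes ξⁱ d_i f, which joins the divergence term f d_i ξⁱ
to form d_i (ξⁱ f); the contact part contributes the symbol of `f` evaluated on the characteristics.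
-/
lemma IsVol.lieD {α : JForm (n + 1) m (n + 1)} {f : JetFun U} (h : IsVol α f)
    (hX : ProjectableOn U X) : IsVol (lieD (prolong X) α) (lieCoeff hX f) := by
  intro z v
  rw [h.lieD_apply (ξ := horComp hX) (fun _ _ => rfl) (symbol_horComp hX)]
  congr 1
  have h1 : (lieCoeff hX f).1 z = (evalChar hX (symbol f)).1 z +
      (∑ i, totDer U i (horComp hX i * f) : JetFun U).1 z := rfl
  have h2 : ∀ i, (totDer U i (horComp hX i * f)).1 z =
      (X (jetBase z.1)).1 i * diff f z (formalDeriv i z.1) +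
        f.1 z * (totDer U i (horComp hX i)).1 z := fun i => diff_mul _ _ _ _
  rw [h1]
  simp only [AddSubmonoidClass.coe_finsetSum, Finset.sum_apply, h2, Finset.sum_add_distrib]
  conv_lhs => rw [← horVec_add_conVec z.1 (prolong X z.1)]
  rw [map_add, diff_vertical f z (conVec_fst _ _), conForm_conVec_prolong hX, horVec_prolong,
    map_sum, Finset.mul_sum]
  simp only [map_smul, smul_eq_mul]
  ring

/-- The Euler–Lagrange expressions of `f vol`. -/
def eulerCoeff (f : JetFun U) (σ : Fin m) : JetFun U := euler (totDer U) (symbol f σ)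

lemma eulerCoeff_divergence (η : Fin (n + 1) → JetFun U) (σ : Fin m) :
    eulerCoeff (∑ i, totDer U i (η i)) σ = 0 := by
  rw [eulerCoeff, symbol_sum, map_sum]
  refine Finset.sum_eq_zero fun i _ => ?_
  rw [symbol_totDer]
  exact euler_symbolDer (D := totDer U) totDer_comm i _

lemma eulerCoeff_add (f g : JetFun U) (σ : Fin m) :
    eulerCoeff (f + g) σ = eulerCoeff f σ + eulerCoeff g σ := by
  rw [eulerCoeff, symbol_add, map_add]; rfl

lemma eulerCoeff_zero (σ : Fin m) : eulerCoeff (0 : JetFun U) σ = 0 := by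
  have := eulerCoeff_add (0 : JetFun U) 0 σ
  simpa using this

lemma IsVol.interiorEuler {α : JForm (n + 1) m (n + 1)} {f : JetFun U} (h : IsVol α f) :
    IsSource (interiorEuler (extD α)) fun σ => Finsupp.single 0 (eulerCoeff f σ) :=
  h.source.euler

/-- Integration by parts in the vertical differential of a function. -/
lemma exists_symbol_eq (f : JetFun U) : ∃ G : Fin (n + 1) → Fin m → Symbol U,
    symbol f = fun σ =>
      Finsupp.single 0 (eulerCoeff f σ) - ∑ i, symbolDer (totDer U) i (G i σ) := by
  choose G hG using fun σ => exists_parts_sub (D := totDer U) totDer_comm (symbol f σ)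
  exact ⟨fun i σ => G σ i, funext hG⟩

/-- The divergence part of the Lie derivative. -/
lemma lieCoeff_eq (hX : ProjectableOn U X) {f : JetFun U} {G : Fin (n + 1) → Fin m → Symbol U}
    (hG : symbol f = fun σ =>
      Finsupp.single 0 (eulerCoeff f σ) - ∑ i, symbolDer (totDer U) i (G i σ)) :
    lieCoeff hX f = ∑ σ, eulerCoeff f σ * characteristic hX σ +
      ∑ i, totDer U i (horComp hX i * f - evalChar hX (G i)) := by
  have h : evalChar hX (symbol f) = ∑ σ, eulerCoeff f σ * characteristic hX σ -
      ∑ i, totDer U i (evalChar hX (G i)) := by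
    have h1 : ∀ σ, symbolEval (totDer U) (characteristic hX σ) (symbol f σ) =
        eulerCoeff f σ * characteristic hX σ -
          ∑ i, totDer U i (symbolEval (totDer U) (characteristic hX σ) (G i σ)) := fun σ => by
      rw [hG]
      exact symbolEval_parts (D := totDer U) totDer_comm _ _ _
    rw [evalChar, Finset.sum_congr rfl fun σ _ => h1 σ, Finset.sum_sub_distrib, Finset.sum_comm]
    simp only [evalChar, map_sum]
  rw [lieCoeff, h]
  simp only [map_sub, Finset.sum_sub_distrib]
  abel

/-- By integration by parts the Lie derivative differs from E_τ Q^τ by a divergence, which the Euler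
operator annihilates. This carries both the use of the Jacobi condition and the induction. -/
lemma eulerCoeff_lieCoeff (hX : ProjectableOn U X) (f : JetFun U) (σ : Fin m) :
    eulerCoeff (lieCoeff hX f) σ =
      eulerCoeff (∑ τ, eulerCoeff f τ * characteristic hX τ) σ := by
  obtain ⟨G, hG⟩ := exists_symbol_eq f
  rw [lieCoeff_eq hX hG, eulerCoeff_add, eulerCoeff_divergence, add_zero]

lemma IsSource.add {α β : JForm (n + 1) m (n + 2)} {F G : Fin m → Symbol U}
    (hF : IsSource α F) (hG : IsSource β G) :
    IsSource (fun z v => α z v + β z v) fun σ => F σ + G σ := by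
  intro z v
  change α z.1 v + β z.1 v = _
  rw [hF, hG, ← Finset.sum_add_distrib]
  refine Finset.sum_congr rfl fun j _ => ?_
  simp only [conForm_apply, map_add, LinearMap.add_apply, Finset.sum_add_distrib]
  ring

lemma Symbol.sub_eq_add_neg (F G : Symbol U) : F - G = F + -G := _root_.sub_eq_add_neg F G

/-- The divergence part of the symbol defines a momentum that is a residual. It depends only on the
coefficient over `U`, so a single `R` serves all Lagrangians with that coefficient. -/
lemma exists_isResidual (f : JetFun U) : ∃ R : JForm (n + 1) m (n + 1),
    ∀ lam, IsVol lam f → IsResidual (U : Set (FibCoord (n + 1) m)) (extD lam) R := by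
  obtain ⟨G, hG⟩ := exists_symbol_eq f
  have hR := isMomentum_momentumForm G
  refine ⟨momentumForm G, fun lam hlam => ⟨finiteOrder_momentumForm G,
    fun z hz v => hR.horiz_eq_zero ⟨z, hz⟩ v, fun z hz v => ?_⟩⟩
  have h1 := hlam.source ⟨z, hz⟩ v
  have h2 := (hlam.interiorEuler.add hR.pCon_one.source) ⟨z, hz⟩ v
  rw [h1]
  refine Eq.trans ?_ h2.symm
  rw [hG]
  simp only [Symbol.sub_eq_add_neg]

/-- The residual equation is an equality of source forms, and source forms determine their symbols.
Thus an arbitrary residual yields a decomposition as good as the one built from integration by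
parts. -/
lemma IsVol.exists_symbol_eq_of_isResidual {lam R : JForm (n + 1) m (n + 1)} {f : JetFun U}
    (h : IsVol lam f) (hR : IsResidual (U : Set (FibCoord (n + 1) m)) (extD lam) R) :
    ∃ G, IsMomentum (pCon 1 R) G ∧ symbol f = fun σ =>
      Finsupp.single 0 (eulerCoeff f σ) - ∑ i, symbolDer (totDer U) i (G i σ) := by
  obtain ⟨G, hG⟩ := FiniteOrder.exists_momentum hR.1
  refine ⟨G, hG, ?_⟩
  have := h.source.unique (h.interiorEuler.add hG.source) fun z v => hR.2.2 z.1 z.2 v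
  rw [this]
  simp only [Symbol.sub_eq_add_neg]

lemma IsMomentum.noetherCurrent {lam R : JForm (n + 1) m (n + 1)} {f : JetFun U}
    {G : Fin (n + 1) → Fin m → Symbol U} (hG : IsMomentum (pCon 1 R) G) (h : IsVol lam f)
    (hX : ProjectableOn U X) :
    IsCurrent (noetherCurrent X R lam) fun i => horComp hX i * f - evalChar hX (G i) := by
  intro z u
  have h1 : contr (fun z => horVec z (prolong X z)) lam z.1 u =
      ∑ i, (horComp hX i).1 z * f.1 z * ds i u := by
    rw [contr, h, vol_cons, Finset.mul_sum]
    refine Finset.sum_congr rfl fun i _ => ?_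
    rw [horVec_eq, horLift_fst, prolong_fst]
    have : (horComp hX i).1 z = (X (jetBase z.1)).1 i := rfl
    rw [this]
    ring
  have h2 : contr (fun z => conVec z (prolong X z)) (fun z v => - pCon 1 R z v) z.1 u =
      -∑ i, (evalChar hX (G i)).1 z * ds i u := by
    rw [contr, hG]
    congr 1
    refine Finset.sum_congr rfl fun i _ => ?_
    rw [Fin.sum_univ_succ, Finset.sum_eq_zero, add_zero]
    · simp only [Fin.val_zero, pow_zero, one_mul, Fin.cons_zero, Fin.removeNth_zero, Fin.tail_cons]
      rw [conVec_of_vertical _ (conVec_fst _ _), conForm_conVec_prolong hX]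
    · intro j _
      obtain ⟨a, ha⟩ := exists_removeNth_eq (Fin.succ_ne_zero j).symm
        (Fin.cons (conVec z.1 (prolong X z.1)) u : Fin (n + 1) → Jet (n + 1) m)
      rw [ds_eq_zero i (j := a), mul_zero, mul_zero]
      rw [ha]
      exact conVec_fst _ _
  rw [_root_.noetherCurrent, h1, h2, neg_add_eq_sub, ← Finset.sum_sub_distrib]
  refine Finset.sum_congr rfl fun i _ => ?_
  rw [← sub_mul]
  rfl

/-- The first variation formula. -/
lemma IsVol.dH_noetherCurrent {lam R : JForm (n + 1) m (n + 1)} {f : JetFun U} (h : IsVol lam f)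
    (hR : IsResidual (U : Set (FibCoord (n + 1) m)) (extD lam) R) (hX : ProjectableOn U X) :
    IsVol (dH (noetherCurrent X R lam))
      (lieCoeff hX f - ∑ σ, eulerCoeff f σ * characteristic hX σ) := by
  obtain ⟨G, hG, hf⟩ := h.exists_symbol_eq_of_isResidual hR
  rw [lieCoeff_eq hX hf, add_sub_cancel_left]
  exact (hG.noetherCurrent h hX).isVol_dH

lemma IsVol.unique {lam : JForm (n + 1) m (n + 1)} {f g : JetFun U} (hf : IsVol lam f)
    (hg : IsVol lam g) : f = g := by
  refine Subtype.ext (funext fun z => ?_)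
  have h1 := hf z fun i => formalDeriv i z.1
  rw [hg, vol_formalDeriv, mul_one, mul_one] at h1
  exact h1.symm

/-- The condition on Jacobi fields in terms of Euler–Lagrange expressions. -/
lemma IsVol.eulerCoeff_of_jacobi {lam : JForm (n + 1) m (n + 1)} {f : JetFun U} (h : IsVol lam f)
    (hX : ProjectableOn U X) (hver : ∀ p ∈ U, (X p).1 = 0)
    (hJ : ∀ z, jetBase z ∈ U → ∀ v, _root_.interiorEuler (extD (contr (prolong X)
      (_root_.interiorEuler (extD lam)))) z v = 0) (σ : Fin m) :
    eulerCoeff (lieCoeff hX f) σ = 0 := by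
  -- For a vertical field the prolongation equals its contact part, so the contraction pairs the
  -- Euler–Lagrange expressions with the characteristics.
  have h1 : IsVol (contr (prolong X) (_root_.interiorEuler (extD lam)))
      (∑ τ, eulerCoeff f τ * characteristic hX τ) := by
    have hp : ∀ z : Over U, (prolong X z.1).1 = 0 := fun z => hver _ z.2
    refine h.interiorEuler.contr_vertical hp fun z => ?_
    rw [← evalChar_single_zero, ← conForm_conVec_prolong hX, conVec_of_vertical _ (hp z)]
  have h2 : IsSource (fun _ _ => 0) (0 : Fin m → Symbol U) := fun z v => by
    simp [conForm_apply]
  have h3 := congrFun (h1.interiorEuler.unique h2 fun z v => hJ z.1 z.2 v) σ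
  rw [eulerCoeff_lieCoeff]
  exact Finsupp.single_eq_zero.1 h3

lemma isVol_horiz {α : JForm (n + 1) m (n + 1)} (hα : FiniteOrder U α) :
    ∃ f : JetFun U, IsVol (horiz α) f := by
  obtain ⟨k, α', h1, h2⟩ := id hα
  obtain ⟨f, hf⟩ := exists_jetFun_alternating h1 (W := fun i => formalDeriv i)
    fun i => isJetField_formalDeriv i
  refine ⟨f, fun z v => ?_⟩
  obtain ⟨A, hA⟩ := hα.alternating z
  rw [horiz, pCon_zero_lagrangian hA, ← hA, h2 z.1 z.2, hf]

end Fields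

/-! ### Iterated currents -/

section Iteration

variable {n m : ℕ} {U : Opens (FibCoord (n + 1) m)}
  {X : ℕ → FibCoord (n + 1) m → FibCoord (n + 1) m} {lam : ℕ → JForm (n + 1) m (n + 1)}

/-- `α` and `β` are the same Lagrangian over `U`, with vanishing Euler–Lagrange expressions. -/
def IsSameTrivial (U : Opens (FibCoord (n + 1) m)) (α β : JForm (n + 1) m (n + 1)) : Prop :=
  ∃ f : JetFun U, IsVol α f ∧ IsVol β f ∧ ∀ σ, eulerCoeff f σ = 0

/-- The induction step: with zero Euler–Lagrange expressions the term E_σ Q^σ disappears from the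
first variation formula, and it is also all that could contribute to the Euler–Lagrange expressions
of the Lie derivative. -/
lemma IsSameTrivial.dH_noetherCurrent {Z : FibCoord (n + 1) m → FibCoord (n + 1) m}
    {α β R : JForm (n + 1) m (n + 1)} (h : IsSameTrivial U α β) (hZ : ProjectableOn U Z)
    (hR : IsResidual (U : Set (FibCoord (n + 1) m)) (extD α) R) :
    IsSameTrivial U (dH (noetherCurrent Z R α)) (lieD (prolong Z) β) := by
  obtain ⟨f, h1, h2, h3⟩ := h
  refine ⟨lieCoeff hZ f, ?_, h2.lieD hZ, fun σ => ?_⟩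
  · have := h1.dH_noetherCurrent hR hZ
    simpa [h3] using this
  · rw [eulerCoeff_lieCoeff]
    simp [h3, eulerCoeff_zero]

/-- The residual property is required only once agreement with `lam j` is known. In this form the
lemma applies both to a given chain and to the construction of one. -/
lemma iterCurrent_isSameTrivial {N : ℕ}
    (hX : ∀ j, 1 ≤ j → j ≤ N → ProjectableOn U (X j))
    (hlam : ∀ j < N, lam (j + 1) = lieD (prolong (X (j + 1))) (lam j))
    (h0 : IsSameTrivial U (lam 0) (lam 0)) {R : ℕ → JForm (n + 1) m (n + 1)}
    (hR : ∀ j < N, IsSameTrivial U (iterCurrent X R (lam 0) j) (lam j) →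
      IsResidual (U : Set (FibCoord (n + 1) m)) (extD (iterCurrent X R (lam 0) j)) (R j)) :
    ∀ j ≤ N, IsSameTrivial U (iterCurrent X R (lam 0) j) (lam j) := by
  intro j
  induction j with
  | zero => exact fun _ => h0
  | succ j ih =>
    intro hj
    have h := ih (by omega)
    rw [hlam j (by omega)]
    exact h.dH_noetherCurrent (hX (j + 1) (by omega) hj) (hR j (by omega) h)

/-- The successive Lagrangians depend on the earlier residuals, but they share the coefficients of
`lam j`. Residuals can therefore be chosen for each `lam j` separately, with no recursive choice. -/
lemma exists_isResidualChain {N : ℕ}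
    (hX : ∀ j, 1 ≤ j → j ≤ N → ProjectableOn U (X j))
    (hlam : ∀ j < N, lam (j + 1) = lieD (prolong (X (j + 1))) (lam j))
    (h0 : IsSameTrivial U (lam 0) (lam 0)) :
    ∃ R, IsResidualChain (U : Set (FibCoord (n + 1) m)) X (lam 0) N R := by
  have h : ∀ j, ∃ R : JForm (n + 1) m (n + 1), ∀ α, IsSameTrivial U α (lam j) →
      IsResidual (U : Set (FibCoord (n + 1) m)) (extD α) R := fun j => by
    by_cases hj : ∃ f : JetFun U, IsVol (lam j) f
    · obtain ⟨f, hf⟩ := hj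
      obtain ⟨R, hR⟩ := exists_isResidual f
      refine ⟨R, fun α hα => ?_⟩
      obtain ⟨g, h1, h2, -⟩ := hα
      exact hR α (h2.unique hf ▸ h1)
    -- A dummy value: if `lam j` has no coefficient, no Lagrangian satisfies the premise.
    · refine ⟨fun _ _ => 0, fun α hα => ?_⟩
      obtain ⟨g, -, h2, -⟩ := hα
      exact absurd ⟨g, h2⟩ hj
  choose R hR using h
  refine ⟨R, fun j hj => hR j _ ?_⟩
  exact iterCurrent_isSameTrivial hX hlam h0 (fun j _ h => hR j _ h) j hj.le

end Iteration

/-! ### Fibered charts -/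

section Charts

variable {n m : ℕ} {X Y : Type*}
  [TopologicalSpace X] [ChartedSpace (Fin n → ℝ) X]
  [TopologicalSpace Y] [ChartedSpace (FibCoord n m) Y]
  {π : Y → X}

/-- The domain of a fibered chart, as an open set. -/
def chartDom (c : FiberedChart n m π) : Opens (FibCoord n m) := ⟨c.dom, c.chartY.open_target⟩

/-- Differentiate pr₁ ∘ `chartY` = `chartX` ∘ π near the point in two ways. -/
lemma repField_fst (hπ : ContMDiff 𝓘(ℝ, FibCoord n m) 𝓘(ℝ, Fin n → ℝ) ∞ π)
    (c : FiberedChart n m π) (ψ : (y : Y) → TangentSpace 𝓘(ℝ, FibCoord n m) y)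
    {p : FibCoord n m} (hp : p ∈ c.dom) :
    (c.repField ψ p).1 = mfderiv 𝓘(ℝ, Fin n → ℝ) 𝓘(ℝ, Fin n → ℝ) c.chartX
      (π (c.chartY.symm p)) (mfderiv 𝓘(ℝ, FibCoord n m) 𝓘(ℝ, Fin n → ℝ) π (c.chartY.symm p)
        (ψ (c.chartY.symm p))) := by
  set y := c.chartY.symm p with hy
  have hys : y ∈ c.chartY.source := c.chartY.map_target hp
  have h1 : HasMFDerivAt 𝓘(ℝ, FibCoord n m) 𝓘(ℝ, FibCoord n m) c.chartY y
      (mfderiv 𝓘(ℝ, FibCoord n m) 𝓘(ℝ, FibCoord n m) c.chartY y) :=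
    ((contMDiffAt_of_mem_maximalAtlas c.chartY_mem hys).mdifferentiableAt (by simp)).hasMFDerivAt
  have h2 : HasMFDerivAt 𝓘(ℝ, Fin n → ℝ) 𝓘(ℝ, Fin n → ℝ) c.chartX (π y)
      (mfderiv 𝓘(ℝ, Fin n → ℝ) 𝓘(ℝ, Fin n → ℝ) c.chartX (π y)) :=
    ((contMDiffAt_of_mem_maximalAtlas c.chartX_mem (c.map_source y hys)).mdifferentiableAt
      (by simp)).hasMFDerivAt
  have h3 : HasMFDerivAt 𝓘(ℝ, FibCoord n m) 𝓘(ℝ, Fin n → ℝ) π y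
      (mfderiv 𝓘(ℝ, FibCoord n m) 𝓘(ℝ, Fin n → ℝ) π y) :=
    ((hπ y).mdifferentiableAt (by simp)).hasMFDerivAt
  have h4 : HasMFDerivAt 𝓘(ℝ, FibCoord n m) 𝓘(ℝ, Fin n → ℝ)
      (Prod.fst : FibCoord n m → Fin n → ℝ) (c.chartY y)
      (ContinuousLinearMap.fst ℝ (Fin n → ℝ) (Fin m → ℝ)) :=
    (ContinuousLinearMap.fst ℝ (Fin n → ℝ) (Fin m → ℝ)).hasFDerivAt.hasMFDerivAt
  have h5 := h4.comp y h1
  have h6 := h2.comp y h3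
  have h7 : (Prod.fst : FibCoord n m → Fin n → ℝ) ∘ c.chartY =ᶠ[𝓝 y] c.chartX ∘ π := by
    filter_upwards [c.chartY.open_source.mem_nhds hys] with w hw using c.fst_eq w hw
  have h8 := hasMFDerivAt_unique h5 (h6.congr_of_eventuallyEq h7)
  exact congrArg (fun L => L (ψ y)) h8

lemma contDiffOn_repField [IsManifold 𝓘(ℝ, FibCoord n m) ∞ Y] (c : FiberedChart n m π)
    {ψ : (y : Y) → TangentSpace 𝓘(ℝ, FibCoord n m) y}
    (hψ : ContMDiff 𝓘(ℝ, FibCoord n m) (𝓘(ℝ, FibCoord n m).tangent) ∞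
      (fun y => (⟨y, ψ y⟩ : TangentBundle 𝓘(ℝ, FibCoord n m) Y))) :
    ContDiffOn ℝ ∞ (c.repField ψ) c.dom := by
  have h1 : ContMDiffOn 𝓘(ℝ, FibCoord n m) 𝓘(ℝ, FibCoord n m) ∞ c.chartY.symm c.dom :=
    contMDiffOn_symm_of_mem_maximalAtlas c.chartY_mem
  have h2 := (contMDiffOn_of_mem_maximalAtlas c.chartY_mem).contMDiffOn_tangentMapWithin
    (m := ∞) le_rfl c.chartY.open_source.uniqueMDiffOn
  have h3 := h2.comp (hψ.comp_contMDiffOn h1) fun p hp => c.chartY.map_target hp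
  have h4 := (contMDiff_snd_tangentBundle_modelSpace (n := ∞) (FibCoord n m)
    𝓘(ℝ, FibCoord n m)).comp_contMDiffOn h3
  refine (contMDiffOn_iff_contDiffOn.1 h4).congr fun p hp => ?_
  have hs : c.chartY.symm p ∈ c.chartY.source := c.chartY.map_target hp
  change _ = mfderivWithin 𝓘(ℝ, FibCoord n m) 𝓘(ℝ, FibCoord n m) c.chartY c.chartY.source
    (c.chartY.symm p) (ψ (c.chartY.symm p))
  rw [mfderivWithin_of_isOpen c.chartY.open_source hs]
  rfl

end Charts

/-! ### Variations of a form in a fibered chart. -/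

section Main

variable {n m : ℕ} {X Y : Type*}
  [TopologicalSpace X] [ChartedSpace (Fin (n + 1) → ℝ) X]
  [TopologicalSpace Y] [ChartedSpace (FibCoord (n + 1) m) Y]
  [IsManifold 𝓘(ℝ, FibCoord (n + 1) m) ∞ Y]
  {π : Y → X}

/-- The base components are the image of the projected field ξ at π(y), and in a fibered chart π(y)
depends only on the first coordinate. -/
lemma projectableOn_repField
    (hπ : ContMDiff 𝓘(ℝ, FibCoord (n + 1) m) 𝓘(ℝ, Fin (n + 1) → ℝ) ∞ π)
    (c : FiberedChart (n + 1) m π) {ψ : (y : Y) → TangentSpace 𝓘(ℝ, FibCoord (n + 1) m) y}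
    (hψ : IsProjectableField (n + 1) m π ψ) : ProjectableOn (chartDom c) (c.repField ψ) := by
  obtain ⟨h1, ξ, hξ⟩ := hψ
  refine ⟨contDiffOn_repField c h1, fun p hp p' hp' h => ?_⟩
  have hs : ∀ p ∈ c.dom, π (c.chartY.symm p) = c.chartX.symm p.1 := fun p hp => by
    have hys : c.chartY.symm p ∈ c.chartY.source := c.chartY.map_target hp
    have h2 := c.fst_eq _ hys
    rw [c.chartY.right_inv hp] at h2
    rw [h2, c.chartX.left_inv (c.map_source _ hys)]
  have hf : ∀ p ∈ c.dom, (c.repField ψ p).1 = mfderiv 𝓘(ℝ, Fin (n + 1) → ℝ)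
      𝓘(ℝ, Fin (n + 1) → ℝ) c.chartX (c.chartX.symm p.1) (ξ (c.chartX.symm p.1)) := fun p hp => by
    rw [repField_fst hπ c ψ hp, hξ, hs p hp]
  rw [hf p hp, hf p' hp', h]

lemma exists_isVol_variation {r l : ℕ}
    (hπ : ContMDiff 𝓘(ℝ, FibCoord (n + 1) m) 𝓘(ℝ, Fin (n + 1) → ℝ) ∞ π)
    (ρ : FormOnJets (n := n + 1) (m := m) r (n + 1) π)
    (ψ : ℕ → (y : Y) → TangentSpace 𝓘(ℝ, FibCoord (n + 1) m) y)
    (hψ : ∀ k, 1 ≤ k → k ≤ l → IsProjectableField (n + 1) m π (ψ k))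
    (c : FiberedChart (n + 1) m π) {k : ℕ} (hk : k ≤ l) :
    ∃ f : JetFun (chartDom c), IsVol (variation ρ ψ c k) f := by
  induction k with
  | zero =>
    exact isVol_horiz ⟨r, ρ.rep c, ρ.smooth c, fun _ _ _ => rfl⟩
  | succ k ih =>
    obtain ⟨f, hf⟩ := ih (by omega)
    exact ⟨_, hf.lieD (projectableOn_repField hπ c (hψ (k + 1) (by omega) hk))⟩

end Main

end JetVariation

end

open JetVariation in
/-- The base has dimension `n + 1 ≥ 1`, so that currents are `n`-forms. -/
theorem theorem4p4 {n m r : ℕ} {X Y : Type*}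
    [TopologicalSpace X] [ChartedSpace (Fin (n + 1) → ℝ) X]
    [IsManifold 𝓘(ℝ, Fin (n + 1) → ℝ) ∞ X]
    [TopologicalSpace Y] [ChartedSpace (FibCoord (n + 1) m) Y]
    [IsManifold 𝓘(ℝ, FibCoord (n + 1) m) ∞ Y]
    (π : Y → X)
    (hπ : ContMDiff 𝓘(ℝ, FibCoord (n + 1) m) 𝓘(ℝ, Fin (n + 1) → ℝ) ∞ π)
    (hπ_surj : Function.Surjective π)
    (hπ_subm : ∀ y, Function.Surjective
      (mfderiv 𝓘(ℝ, FibCoord (n + 1) m) 𝓘(ℝ, Fin (n + 1) → ℝ) π y))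
    (ρ : FormOnJets (n := n + 1) (m := m) r (n + 1) π)
    (ψ : ℕ → (y : Y) → TangentSpace 𝓘(ℝ, FibCoord (n + 1) m) y)
    (s l : ℕ) (hs : 1 ≤ s) (hsl : s < l)
    (hψ : ∀ k, 1 ≤ k → k ≤ l → IsProjectableField (n + 1) m π (ψ k))
    (hsymm : IsLagrangianSymmetry (fun c => variation ρ ψ c (l - 1)) (ψ l))
    (hJacobi : IsJacobiField (fun c => variation ρ ψ c (s - 1)) (ψ s))
    (c : FiberedChart (n + 1) m π) :
    (∃ R : ℕ → JForm (n + 1) m (n + 1),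
      IsResidualChain c.dom (fun j => c.repField (ψ (s + j))) (variation ρ ψ c s) (l - s) R) ∧
    ∀ R : ℕ → JForm (n + 1) m (n + 1),
      IsResidualChain c.dom (fun j => c.repField (ψ (s + j))) (variation ρ ψ c s) (l - s) R →
      c.Vanishes (iterCurrent (fun j => c.repField (ψ (s + j))) R (variation ρ ψ c s) (l - s)) := by
  have hX : ∀ j, 1 ≤ j → j ≤ l - s → ProjectableOn (chartDom c) (c.repField (ψ (s + j))) :=
    fun j _ hj => projectableOn_repField hπ c (hψ _ (by omega) (by omega))
  -- The start of the induction: λ_s is the Lie derivative of λ_{s-1} along a Jacobi field of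
  -- λ_{s-1}, so its Euler–Lagrange expressions vanish.
  have h0 : IsSameTrivial (chartDom c) (variation ρ ψ c s) (variation ρ ψ c s) := by
    obtain ⟨t, rfl⟩ := Nat.exists_eq_add_of_le' hs
    obtain ⟨f, hf⟩ := exists_isVol_variation hπ ρ ψ hψ c (k := t) (by omega)
    have hp := projectableOn_repField hπ c (hψ (t + 1) hs hsl.le)
    refine ⟨_, hf.lieD hp, hf.lieD hp, fun σ => ?_⟩
    refine hf.eulerCoeff_of_jacobi hp (fun p hp => ?_) (hJacobi.2 c) σ
    rw [repField_fst hπ c _ hp, hJacobi.1, map_zero]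
    rfl
  refine ⟨exists_isResidualChain (lam := fun j => variation ρ ψ c (s + j)) hX (fun _ _ => rfl) h0,
    fun R hR z hz v => ?_⟩
  obtain ⟨f, h1, h2, -⟩ := iterCurrent_isSameTrivial (lam := fun j => variation ρ ψ c (s + j))
    hX (fun _ _ => rfl) h0 (fun j hj _ => hR j hj) (l - s) le_rfl
  have h3 := (h1 ⟨z, hz⟩ v).trans (h2 ⟨z, hz⟩ v).symm
  refine h3.trans ?_
  have h4 := hsymm c z hz v
  -- Since l ≥ 1, the variation λ_l unfolds to the Lie derivative of λ_{l-1} along ψ_l, which is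
  -- what the symmetry assumption annihilates.
  obtain ⟨l, rfl⟩ := Nat.exists_eq_add_of_le' (hs.trans hsl.le)
  have h5 : s + (l + 1 - s) = l + 1 := by omega
  change variation ρ ψ c (s + (l + 1 - s)) z v = 0
  rw [h5]
  exact h4
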